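/- Let $M$ be a smooth $8$-manifold with a $\mathrm{Spin}(7)$-structure, i.e. a smooth $4$-form $\Omega$ which at each point is the pull-back, by an orientation-preserving isomorphism $T_xM\to\mathbb R^8$, of the Cayley form $$\Omega_0=dx_{1234}-dx_{1278}-dx_{1638}-dx_{1674}+dx_{1526}+dx_{1537}+dx_{1548}+dx_{5678}-dx_{5634}-dx_{5274}-dx_{5238}+dx_{3748}+dx_{2648}+dx_{2637},$$ and let $g$ be the induced metric. Put $\Lambda^2_7=\{\alpha\in\Lambda^2T^*M : *(\alpha\wedge\Omega)=3\alpha\}$ and let $\pi_7:\Lambda^2\to\Lambda^2_7$ be the orthogonal projection. Let $S=S^+\oplus S^-$ be a real spinor bundle of $(M,g)$ (a rank-$16$ Riemannian bundle of Clifford modules with smooth, orthogonal Clifford multiplication, $v\cdot v=-|v|^2$, graded by the volume element), and let $\eta\in\Gamma(S^+)$ be a unit spinor associated to $\Omega$, i.e. $\Omega(u_1,u_2,u_3,u_4)=-\langle u_1\cdot u_2\cdot u_3\cdot u_4\cdot\eta,\eta\rangle$ for orthonormal $u_1,\dots,u_4$. Let $\nabla^T$ be the Ivanov connection, the metric connection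 on $TM$ with totally antisymmetric torsion $T(X,Y,Z)=g(\nabla^T_XY-\nabla^T_YX-[X,Y],Z)$ whose lift to $S$ satisfies $\nabla^T\eta=0$. Let $E\to M$ be a real vector bundle with a connection $\nabla_A$, and let $D_T\Psi=\sum_i e_i\cdot\nabla_{e_i}\Psi$ be the Dirac operator on sections of $S\otimes E$ for $\nabla=\nabla^T\otimes1+1\otimes\nabla_A$, with $D_T^-$ its restriction to $S^-\otimes E$. Then $\tau\mapsto\tau\cdot\eta$ is an isomorphism $\Lambda^1\otimes E\cong S^-\otimes E$, $(f,\alpha)\mapsto f\eta+\alpha\cdot\eta$ is an isomorphism $(\Lambda^0\oplus\Lambda^2_7)\otimes E\cong S^+\otimes E$, and through these isomorphisms $$D_T^-\colon\Omega^1(E)\to\Omega^0(E)\oplus\Omega^2_7(E),\qquad \tau\longmapsto d_A^*\tau\ \oplus\ \pi_7\bigl(d_A\tau-\iota_\tau T\bigr),$$ where $(d_A\tau)(X,Y)=\nabla_{A,X}(\tau(Y))-\nabla_{A,Y}(\tau(X))-\tau([X,Y])$, $d_A^*\tau=-\sum_i(\nabla_{e_i}\tau)(e_i)$ with the connection induced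 by the Levi-Civita connection and $\nabla_A$, and $\iota_\tau T=\sum_iT(e_i,\cdot,\cdot)\otimes\tau(e_i)$ for an orthonormal frame $(e_i)$. -/

import Mathlib

open Bundle Module FiberBundle
open scoped Manifold ContDiff TensorProduct

noncomputable section

namespace Spin7

/-! ### Linear algebra of an oriented Euclidean `8`-space with a `4`-form -/

/-- The `4`-form `dx_a ∧ dx_b ∧ dx_c ∧ dx_d` on `ℝ⁸`, with `idx = (a, b, c, d)` counted from `0`. -/
def dx (idx : Fin 4 → Fin 8) : EuclideanSpace ℝ (Fin 8) [⋀^Fin 4]→ₗ[ℝ] ℝ :=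
  (Matrix.detRowAlternating (n := Fin 4) (R := ℝ)).compLinearMap
    (LinearMap.pi fun k => (EuclideanSpace.proj (𝕜 := ℝ) (idx k)).toLinearMap)

/-- The standard Cayley form `Ω₀` on `ℝ⁸`:
`dx₁₂₃₄ - dx₁₂₇₈ - dx₁₆₃₈ - dx₁₆₇₄ + dx₁₅₂₆ + dx₁₅₃₇ + dx₁₅₄₈ + dx₅₆₇₈ - dx₅₆₃₄ - dx₅₂₇₄ - dx₅₂₃₈
+ dx₃₇₄₈ + dx₂₆₄₈ + dx₂₆₃₇`. -/
def Omega₀ : EuclideanSpace ℝ (Fin 8) [⋀^Fin 4]→ₗ[ℝ] ℝ :=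
  dx ![0, 1, 2, 3] - dx ![0, 1, 6, 7] - dx ![0, 5, 2, 7] - dx ![0, 5, 6, 3]
    + dx ![0, 4, 1, 5] + dx ![0, 4, 2, 6] + dx ![0, 4, 3, 7]
    + dx ![4, 5, 6, 7] - dx ![4, 5, 2, 3] - dx ![4, 1, 6, 3] - dx ![4, 1, 2, 7]
    + dx ![2, 6, 3, 7] + dx ![1, 5, 3, 7] + dx ![1, 5, 2, 6]

section LinearAlgebra

section Forms

variable {V : Type*} [AddCommGroup V] [Module ℝ V] {W : Type*} [AddCommGroup W] [Module ℝ W]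

/-- The wedge product of a `W`-valued `p`-form and a real `q`-form (the sum over `(p,q)`-shuffles). -/
def wedge {p q : ℕ} (α : V [⋀^Fin p]→ₗ[ℝ] W) (β : V [⋀^Fin q]→ₗ[ℝ] ℝ) :
    V [⋀^Fin (p + q)]→ₗ[ℝ] W :=
  ((TensorProduct.rid ℝ W).toLinearMap.compAlternatingMap (α.domCoprod β)).domDomCongr
    finSumFinEquiv

theorem wedge_add {p q : ℕ} (α α' : V [⋀^Fin p]→ₗ[ℝ] W) (β : V [⋀^Fin q]→ₗ[ℝ] ℝ) :
    wedge (α + α') β = wedge α β + wedge α' β := by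
  ext v
  simp [wedge, ← AlternatingMap.domCoprod'_apply, TensorProduct.add_tmul]

theorem wedge_smul {p q : ℕ} (c : ℝ) (α : V [⋀^Fin p]→ₗ[ℝ] W) (β : V [⋀^Fin q]→ₗ[ℝ] ℝ) :
    wedge (c • α) β = c • wedge α β := by
  ext v
  simp [wedge, ← AlternatingMap.domCoprod'_apply, ← TensorProduct.smul_tmul']

/-- A covector as a `1`-form. -/
def oneForm (φ : V →ₗ[ℝ] ℝ) : V [⋀^Fin 1]→ₗ[ℝ] ℝ :=
  AlternatingMap.ofSubsingleton ℝ V ℝ (0 : Fin 1) φ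

/-- The form `β ⊗ w`. -/
def formTensor {k : ℕ} (β : V [⋀^Fin k]→ₗ[ℝ] ℝ) (w : W) : V [⋀^Fin k]→ₗ[ℝ] W :=
  (LinearMap.toSpanSingleton ℝ W w).compAlternatingMap β

theorem formTensor_add {k : ℕ} (β : V [⋀^Fin k]→ₗ[ℝ] ℝ) (w w' : W) :
    formTensor β (w + w') = formTensor β w + formTensor β w' := by
  ext v
  simp [formTensor]

theorem formTensor_smul {k : ℕ} (β : V [⋀^Fin k]→ₗ[ℝ] ℝ) (c : ℝ) (w : W) :
    formTensor β (c • w) = c • formTensor β w := by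
  ext v
  simp [formTensor, smul_comm c]

/-- The `2`-form attached to a bilinear map that vanishes on the diagonal. -/
def twoFormOfBilin (B : V →ₗ[ℝ] V →ₗ[ℝ] W) (hB : ∀ v, B v v = 0) : V [⋀^Fin 2]→ₗ[ℝ] W where
  toFun v := B (v 0) (v 1)
  map_update_add' v i a b := by
    fin_cases i <;> simp
  map_update_smul' v i c a := by
    fin_cases i <;> simp
  map_eq_zero_of_eq' v i j h hij := by
    fin_cases i <;> fin_cases j <;> simp_all

/-- `contract φ u = φ(u₁, …, u_k, ·, …, ·)`. -/
def contract {l : ℕ} : {k : ℕ} → (V [⋀^Fin (l + k)]→ₗ[ℝ] ℝ) → (Fin k → V) → V [⋀^Fin l]→ₗ[ℝ] ℝ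
  | 0, φ, _ => φ
  | _ + 1, φ, u => contract (φ.curryLeft (u 0)) (Fin.tail u)

end Forms

variable {V : Type*} [NormedAddCommGroup V] [InnerProductSpace ℝ V] [FiniteDimensional ℝ V]
  {W : Type*} [AddCommGroup W] [Module ℝ W]

/-- The Hodge star of a `W`-valued `k`-form with respect to the volume form `vol`, where
`dim V = l + k`: `(⋆γ)(w) = ∑_I γ(e_I) vol(e_I, w)`, the sum being over the `k`-element subsets of
an orthonormal basis (here: over all `k`-tuples of basis vectors, divided by `k!`). -/
def hodgeStar {k l : ℕ} (vol : V [⋀^Fin (l + k)]→ₗ[ℝ] ℝ) (γ : V [⋀^Fin k]→ₗ[ℝ] W) :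
    V [⋀^Fin l]→ₗ[ℝ] W :=
  (k.factorial : ℝ)⁻¹ • ∑ f : Fin k → Fin (finrank ℝ V),
    formTensor (contract vol fun j => stdOrthonormalBasis ℝ V (f j))
      (γ fun j => stdOrthonormalBasis ℝ V (f j))

theorem hodgeStar_add {k l : ℕ} (vol : V [⋀^Fin (l + k)]→ₗ[ℝ] ℝ) (γ γ' : V [⋀^Fin k]→ₗ[ℝ] W) :
    hodgeStar vol (γ + γ') = hodgeStar vol γ + hodgeStar vol γ' := by
  simp only [hodgeStar, AlternatingMap.add_apply, formTensor_add, Finset.sum_add_distrib, smul_add]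

theorem hodgeStar_smul {k l : ℕ} (vol : V [⋀^Fin (l + k)]→ₗ[ℝ] ℝ) (c : ℝ)
    (γ : V [⋀^Fin k]→ₗ[ℝ] W) : hodgeStar vol (c • γ) = c • hodgeStar vol γ := by
  simp only [hodgeStar, AlternatingMap.smul_apply, formTensor_smul, ← Finset.smul_sum]
  rw [smul_comm]

/-- Components of a real `2`-form in an orthonormal basis. -/
def twoFormComponents :
    (V [⋀^Fin 2]→ₗ[ℝ] ℝ) →ₗ[ℝ] (Fin (finrank ℝ V) → Fin (finrank ℝ V) → ℝ) where
  toFun α i j := α ![stdOrthonormalBasis ℝ V i, stdOrthonormalBasis ℝ V j]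
  map_add' _ _ := rfl
  map_smul' _ _ := rfl

theorem twoFormComponents_injective :
    Function.Injective (twoFormComponents : (V [⋀^Fin 2]→ₗ[ℝ] ℝ) →ₗ[ℝ] _) := by
  intro α β h
  refine Basis.ext_alternating (stdOrthonormalBasis ℝ V).toBasis fun v _ => ?_
  have := congrFun (congrFun h (v 0)) (v 1)
  have e : (fun i => (stdOrthonormalBasis ℝ V).toBasis (v i)) =
      ![stdOrthonormalBasis ℝ V (v 0), stdOrthonormalBasis ℝ V (v 1)] := by
    ext i; fin_cases i <;> simp
  rw [e]
  exact this

instance : FiniteDimensional ℝ (V [⋀^Fin 2]→ₗ[ℝ] ℝ) :=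
  Module.Finite.of_injective _ twoFormComponents_injective

/-- The inner product `⟨α, β⟩ = ∑_{i<j} α(e_i, e_j) β(e_i, e_j)` on real `2`-forms. -/
@[reducible]
def twoFormCore : InnerProductSpace.Core ℝ (V [⋀^Fin 2]→ₗ[ℝ] ℝ) where
  inner α β := (1 / 2 : ℝ) * ∑ i, ∑ j, twoFormComponents α i j * twoFormComponents β i j
  conj_inner_symm α β := by simp [mul_comm]
  re_inner_nonneg α := by
    simp only [RCLike.re_to_real]
    exact mul_nonneg (by norm_num)
      (Finset.sum_nonneg fun i _ => Finset.sum_nonneg fun j _ => mul_self_nonneg _)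
  add_left α β γ := by
    simp only [map_add, Pi.add_apply, add_mul, Finset.sum_add_distrib, mul_add]
  smul_left α β r := by
    simp only [map_smul, Pi.smul_apply, smul_eq_mul, mul_assoc, ← Finset.mul_sum]
    simp only [conj_trivial]
    ring
  definite α h := by
    apply twoFormComponents_injective
    ext i j
    have h' : ∑ i, ∑ j, twoFormComponents α i j * twoFormComponents α i j = 0 := by
      linarith [h]
    rw [Finset.sum_eq_zero_iff_of_nonneg
      (fun i _ => Finset.sum_nonneg fun j _ => mul_self_nonneg _)] at h'
    have h2 := h' i (Finset.mem_univ _)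
    rw [Finset.sum_eq_zero_iff_of_nonneg (fun j _ => mul_self_nonneg _)] at h2
    simpa using h2 j (Finset.mem_univ _)

variable [Fact (finrank ℝ V = 8)]

/-- `Λ²_7 ⊗ W = {α ∈ Λ² ⊗ W | ⋆(α ∧ Ω) = 3 α}`. -/
def Lambda27 (o : Orientation ℝ V (Fin 8)) (Ω : V [⋀^Fin 4]→ₗ[ℝ] ℝ) (W : Type*)
    [AddCommGroup W] [Module ℝ W] : Submodule ℝ (V [⋀^Fin 2]→ₗ[ℝ] W) where
  carrier := {α | hodgeStar (k := 2 + 4) (l := 2) o.volumeForm (wedge α Ω) = (3 : ℝ) • α}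
  add_mem' {α β} hα hβ := by
    simp only [Set.mem_ofPred_eq] at hα hβ ⊢
    rw [wedge_add, hodgeStar_add, hα, hβ, smul_add]
  zero_mem' := by
    have h := hodgeStar_smul (k := 2 + 4) (l := 2) o.volumeForm 0
      (wedge (0 : V [⋀^Fin 2]→ₗ[ℝ] W) Ω)
    rw [← wedge_smul, zero_smul, zero_smul] at h
    simpa using h
  smul_mem' c α hα := by
    simp only [Set.mem_ofPred_eq] at hα ⊢
    rw [wedge_smul, hodgeStar_smul, hα, smul_comm]

/-- The orthogonal projection `π₇ : Λ² → Λ²_7` on real `2`-forms. -/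
def pi7Real (o : Orientation ℝ V (Fin 8)) (Ω : V [⋀^Fin 4]→ₗ[ℝ] ℝ) :
    (V [⋀^Fin 2]→ₗ[ℝ] ℝ) →ₗ[ℝ] (V [⋀^Fin 2]→ₗ[ℝ] ℝ) :=
  letI : NormedAddCommGroup (V [⋀^Fin 2]→ₗ[ℝ] ℝ) := twoFormCore.toNormedAddCommGroup
  letI : InnerProductSpace ℝ (V [⋀^Fin 2]→ₗ[ℝ] ℝ) := .ofCore twoFormCore.toCore
  ((Lambda27 o Ω ℝ).starProjection).toLinearMap

/-- The map `π₇ ⊗ id_W` on `W`-valued `2`-forms `α = ∑_{i<j} (e^i ∧ e^j) ⊗ α(e_i, e_j)`. -/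
def pi7 (o : Orientation ℝ V (Fin 8)) (Ω : V [⋀^Fin 4]→ₗ[ℝ] ℝ) (α : V [⋀^Fin 2]→ₗ[ℝ] W) :
    V [⋀^Fin 2]→ₗ[ℝ] W :=
  (1 / 2 : ℝ) • ∑ i, ∑ j,
    formTensor
      (pi7Real o Ω (wedge (oneForm (innerₛₗ ℝ (stdOrthonormalBasis ℝ V i)))
        (oneForm (innerₛₗ ℝ (stdOrthonormalBasis ℝ V j)))))
      (α ![stdOrthonormalBasis ℝ V i, stdOrthonormalBasis ℝ V j])

end LinearAlgebra

/-! ### `Spin(7)`-structures on an `8`-manifold -/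

/-- Euclidean `8`-space, the model of the manifold. -/
abbrev E8 : Type := EuclideanSpace ℝ (Fin 8)

section Manifold

variable {M : Type*} [TopologicalSpace M] [ChartedSpace E8 M] [IsManifold (𝓡 8) ∞ M]

instance (x : M) : Fact (finrank ℝ (TangentSpace (𝓡 8) x) = 8) :=
  ⟨(finrank_euclideanSpace_fin : finrank ℝ (EuclideanSpace ℝ (Fin 8)) = 8)⟩

instance (x : M) : FiniteDimensional ℝ (TangentSpace (𝓡 8) x) :=
  inferInstanceAs (FiniteDimensional ℝ (EuclideanSpace ℝ (Fin 8)))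

/-! ### Exterior covariant derivative of a bundle-valued one-form -/

section Twisted

variable {FE : Type*} [NormedAddCommGroup FE] [NormedSpace ℝ FE]
  {E : M → Type*} [TopologicalSpace (TotalSpace FE E)]
  [∀ x, AddCommGroup (E x)] [∀ x, Module ℝ (E x)] [∀ x, TopologicalSpace (E x)]
  [∀ x, IsTopologicalAddGroup (E x)] [∀ x, ContinuousSMul ℝ (E x)]
  [FiberBundle FE E] [VectorBundle ℝ FE E]

variable (FE E) in
/-- `Ω¹(E)`: the smooth sections of `Hom(TM, E)`. -/
abbrev OneForms :=
  ContMDiffSection (𝓡 8) (E8 →L[ℝ] FE) ∞ (fun x : M => TangentSpace (𝓡 8) x →L[ℝ] E x)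

/-- `∇_X(τ(Y)) - ∇_Y(τ(X)) - τ([X, Y])` at the point `x`. -/
def dAux (A : CovariantDerivative (𝓡 8) FE E) (τ : OneForms FE E)
    (X Y : Π y : M, TangentSpace (𝓡 8) y) (x : M) : E x :=
  A (fun y => τ y (Y y)) x (X x) - A (fun y => τ y (X y)) x (Y x)
    - τ x (VectorField.mlieBracket (𝓡 8) X Y x)

theorem mdifferentiableAt_apply (τ : OneForms FE E) {X : Π y : M, TangentSpace (𝓡 8) y} {x : M}
    (hX : MDifferentiableAt (𝓡 8) ((𝓡 8).prod 𝓘(ℝ, E8)) (fun y => TotalSpace.mk' E8 y (X y)) x) :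
    MDifferentiableAt (𝓡 8) ((𝓡 8).prod 𝓘(ℝ, FE))
      (fun y => TotalSpace.mk' FE (E := E) y (τ y (X y))) x :=
  MDifferentiableAt.clm_bundle_apply (F₁ := E8) (F₂ := FE) (b := id)
    ((τ.contMDiff x).mdifferentiableAt (by simp)) hX

theorem dAux_swap (A : CovariantDerivative (𝓡 8) FE E) (τ : OneForms FE E)
    (X Y : Π y : M, TangentSpace (𝓡 8) y) (x : M) : dAux A τ X Y x = -dAux A τ Y X x := by
  rw [dAux, dAux, VectorField.mlieBracket_swap]
  simp only [Pi.neg_apply, map_neg]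
  abel

theorem dAux_tensorial (A : CovariantDerivative (𝓡 8) FE E) (τ : OneForms FE E)
    (Y : Π y : M, TangentSpace (𝓡 8) y) (x : M) :
    TensorialAt (𝓡 8) E8 (fun X => dAux A τ X Y x) x where
  smul {f X} hf hX := by
    have h1 : (fun y => τ y ((f • X) y)) = f • fun y => τ y (X y) := by
      ext y; simp
    simp only [dAux]
    rw [h1, A.isCovariantDerivativeOn.leibniz (mdifferentiableAt_apply τ hX) hf,
      VectorField.mlieBracket_smul_left hf hX]
    simp
    module
  add {X X'} hX hX' := by
    have h1 : (fun y => τ y ((X + X') y)) = (fun y => τ y (X y)) + fun y => τ y (X' y) := by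
      ext y; simp
    simp only [dAux]
    rw [h1, A.isCovariantDerivativeOn.add (mdifferentiableAt_apply τ hX)
      (mdifferentiableAt_apply τ hX'), VectorField.mlieBracket_add_left hX hX']
    simp
    abel

theorem dAux_tensorial' (A : CovariantDerivative (𝓡 8) FE E) (τ : OneForms FE E)
    (X : Π y : M, TangentSpace (𝓡 8) y) (x : M) :
    TensorialAt (𝓡 8) E8 (fun Y => dAux A τ X Y x) x where
  smul hf hY := by
    simp only [dAux_swap A τ X]
    rw [(dAux_tensorial A τ X x).smul hf hY, smul_neg]
  add hY hY' := by
    simp only [dAux_swap A τ X]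
    rw [(dAux_tensorial A τ X x).add hY hY', neg_add]

variable [FiniteDimensional ℝ FE]

/-- The exterior covariant derivative `d_A τ ∈ Ω²(E)`,
`(d_A τ)(X, Y) = ∇_X(τ(Y)) - ∇_Y(τ(X)) - τ([X, Y])` for all vector fields `X`, `Y`. -/
def dA (A : CovariantDerivative (𝓡 8) FE E) (τ : OneForms FE E) (x : M) :
    TangentSpace (𝓡 8) x [⋀^Fin 2]→ₗ[ℝ] E x :=
  let B : TangentSpace (𝓡 8) x →L[ℝ] TangentSpace (𝓡 8) x →L[ℝ] E x :=
    TensorialAt.mkHom₂ (I := 𝓡 8) (F := E8) (F' := E8) (fun X Y => dAux A τ X Y x) x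
      (fun Y _ => dAux_tensorial A τ Y x) (fun X _ => dAux_tensorial' A τ X x)
  twoFormOfBilin (LinearMap.mk₂ ℝ (fun v w => B v w) (by simp) (by simp) (by simp) (by simp))
    fun v => by
    have h : B v v = dAux A τ (extend E8 v) (extend E8 v) x :=
      TensorialAt.mkHom₂_apply_eq_extend _ _ v v
    have h2 := dAux_swap A τ (extend E8 v) (extend E8 v) x
    have h3 : B v v = -B v v := by rw [h]; exact h2
    have h4 : (2 : ℝ) • B v v = 0 := by rw [two_smul]; exact eq_neg_iff_add_eq_zero.mp h3
    exact (smul_eq_zero.mp h4).resolve_left two_ne_zero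

end Twisted

/-! ### The `Spin(7)`-form -/

variable [RiemannianBundle (fun x : M => TangentSpace (𝓡 8) x)]

variable (M) in
/-- A `Spin(7)`-structure on `M`: a smooth `4`-form `Ω` which at every point is `f^*Ω₀` for an
orientation preserving isomorphism `f : T_xM → ℝ⁸`. The Riemannian metric and the orientation are
those induced by `Ω`, i.e. they are pulled back from `ℝ⁸` by `f`
(they do not depend on the choice of `f`). -/
structure Spin7Structure where
  orientation : ∀ x : M, Orientation ℝ (TangentSpace (𝓡 8) x) (Fin 8)
  form : ∀ x : M, TangentSpace (𝓡 8) x [⋀^Fin 4]→ₗ[ℝ] ℝ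
  smooth : ∀ (x : M) (X : Fin 4 → Π y : M, TangentSpace (𝓡 8) y),
    (∀ i, ContMDiffAt (𝓡 8) ((𝓡 8).prod 𝓘(ℝ, E8)) ∞ (fun y => TotalSpace.mk' E8 y (X i y)) x) →
      ContMDiffAt (𝓡 8) 𝓘(ℝ, ℝ) ∞ (fun y => form y fun i => X i y) x
  exists_frame : ∀ x : M, ∃ f : TangentSpace (𝓡 8) x ≃ₗᵢ[ℝ] E8,
    Orientation.map (Fin 8) f.toLinearEquiv (orientation x)
        = (EuclideanSpace.basisFun (Fin 8) ℝ).toBasis.orientation ∧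
      form x = Omega₀.compLinearMap f.toLinearEquiv.toLinearMap

/-! ### Spinor bundles -/

section Spinors

variable {FS : Type*} [NormedAddCommGroup FS] [NormedSpace ℝ FS]
  {S : M → Type*} [TopologicalSpace (TotalSpace FS S)]
  [∀ x, NormedAddCommGroup (S x)] [∀ x, InnerProductSpace ℝ (S x)]
  [FiberBundle FS S] [VectorBundle ℝ FS S]

variable (FS S) in
/-- The structure of a real spinor bundle on the Riemannian bundle `S`: its fibre at `x` is a
module over the Clifford algebra of `T_xM` (with `v · v = -|v|²`) of dimension `16`, that is, an
irreducible one, and Clifford multiplication is smooth and orthogonal. -/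
structure SpinorStructure where
  clifford : ∀ x : M, TangentSpace (𝓡 8) x →L[ℝ] S x →L[ℝ] S x
  smooth : ContMDiff (𝓡 8) ((𝓡 8).prod 𝓘(ℝ, E8 →L[ℝ] FS →L[ℝ] FS)) ∞
    (fun x => TotalSpace.mk' (E8 →L[ℝ] FS →L[ℝ] FS)
      (E := fun x : M => TangentSpace (𝓡 8) x →L[ℝ] S x →L[ℝ] S x) x (clifford x))
  rank_eq : finrank ℝ FS = 16
  clifford_sq : ∀ (x : M) (v : TangentSpace (𝓡 8) x) (s : S x),
    clifford x v (clifford x v s) = -(‖v‖ ^ 2) • s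
  clifford_skew : ∀ (x : M) (v : TangentSpace (𝓡 8) x) (s t : S x),
    inner ℝ (clifford x v s) t = -inner ℝ s (clifford x v t)

/-- The spinors on which the volume element `e₁ ⋯ e₈` (for oriented orthonormal bases) acts by the
scalar `ε`; `ε = 1` gives `S⁺` and `ε = -1` gives `S⁻`. -/
def chiralSpinors (Ω : Spin7Structure M) (c : SpinorStructure FS S) (ε : ℝ) (x : M) :
    Submodule ℝ (S x) where
  carrier := {s | ∀ b : OrthonormalBasis (Fin 8) ℝ (TangentSpace (𝓡 8) x),
    b.toBasis.orientation = Ω.orientation x →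
      (List.ofFn fun i => c.clifford x (b i)).prod s = ε • s}
  add_mem' hs ht b hb := by rw [map_add, hs b hb, ht b hb, smul_add]
  zero_mem' b hb := by rw [map_zero, smul_zero]
  smul_mem' r s hs b hb := by rw [map_smul, hs b hb, smul_comm]

/-- The unit spinor `η ∈ Γ(S⁺)` associated to `Ω`: the one with
`Ω(u₁, u₂, u₃, u₄) = -⟨u₁ · u₂ · u₃ · u₄ · η, η⟩` for orthonormal `u₁, …, u₄`. (The sign is the one
for which the eigenvalue of `α ↦ ⋆(α ∧ Ω)` on the annihilator of `η` in `Λ²` is `-1`.) -/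
structure IsAssociatedSpinor (Ω : Spin7Structure M) (c : SpinorStructure FS S)
    (η : Π x : M, S x) : Prop where
  norm_eq : ∀ x, ‖η x‖ = 1
  positive : ∀ x, η x ∈ chiralSpinors Ω c 1 x
  form_eq : ∀ (x : M) (u : Fin 4 → TangentSpace (𝓡 8) x), Orthonormal ℝ u →
    Ω.form x u = -inner ℝ (c.clifford x (u 0) (c.clifford x (u 1)
      (c.clifford x (u 2) (c.clifford x (u 3) (η x))))) (η x)

/-! ### The Ivanov connection -/

variable [IsContMDiffRiemannianBundle (𝓡 8) ∞ E8 (fun x : M => TangentSpace (𝓡 8) x)]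
  [FiniteDimensional ℝ FS] [ContMDiffVectorBundle ∞ FS S (𝓡 8)]
  [IsContMDiffRiemannianBundle (𝓡 8) ∞ FS S]

instance : IsContMDiffRiemannianBundle (𝓡 8) 1 E8 (fun x : M => TangentSpace (𝓡 8) x) :=
  .of_le (n := ∞) (by simp)

/-- The Ivanov connection of a `Spin(7)`-structure with associated spinor `η`: a metric connection
`∇ᵀ` on `TM` whose torsion is totally antisymmetric, i.e. given by a `3`-form `T`, and whose lift to
the spinor bundle annihilates `η`. The lift is the connection on `S` that is metric and for which
Clifford multiplication is parallel; as `End_{Cl}(S) = ℝ`, it is determined by `∇ᵀ`. -/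
structure IvanovConnection (c : SpinorStructure FS S) (η : Π x : M, S x) where
  /-- the connection `∇ᵀ` on `TM` -/
  tangent : CovariantDerivative (𝓡 8) E8 (fun x : M => TangentSpace (𝓡 8) x)
  /-- the induced spin connection -/
  spin : CovariantDerivative (𝓡 8) FS S
  /-- the torsion `3`-form `T(u, v, w) = g(T(u, v), w)` -/
  torsionForm : ∀ x : M, TangentSpace (𝓡 8) x [⋀^Fin 3]→ₗ[ℝ] ℝ
  tangent_metric : tangent.IsMetricCompatible
  torsion_eq : ∀ (x : M) (u v w : TangentSpace (𝓡 8) x),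
    torsionForm x ![u, v, w] = inner ℝ (tangent.torsion x u v) w
  spin_metric : spin.IsMetricCompatible
  spin_clifford : ∀ (x : M) (Y : Π y : M, TangentSpace (𝓡 8) y) (σ : Π y : M, S y),
    MDifferentiableAt (𝓡 8) ((𝓡 8).prod 𝓘(ℝ, E8)) (fun y => TotalSpace.mk' E8 y (Y y)) x →
    MDifferentiableAt (𝓡 8) ((𝓡 8).prod 𝓘(ℝ, FS)) (fun y => TotalSpace.mk' FS y (σ y)) x →
    ∀ v : TangentSpace (𝓡 8) x,
      spin (fun y => c.clifford y (Y y) (σ y)) x v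
        = c.clifford x (tangent Y x v) (σ x) + c.clifford x (Y x) (spin σ x v)
  parallel : ∀ x : M, spin η x = 0

end Spinors

/-! ### Levi-Civita connection and codifferential -/

/-- The right-hand side of the Koszul formula for `2 g(∇_X Y, Z)` at `x`. -/
def koszul (X Y Z : Π y : M, TangentSpace (𝓡 8) y) (x : M) : ℝ :=
  mvfderiv (𝓡 8) (fun y => inner ℝ (Y y) (Z y)) x (X x)
    + mvfderiv (𝓡 8) (fun y => inner ℝ (X y) (Z y)) x (Y x)
    - mvfderiv (𝓡 8) (fun y => inner ℝ (X y) (Y y)) x (Z x)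
    + inner ℝ (VectorField.mlieBracket (𝓡 8) X Y x) (Z x)
    - inner ℝ (VectorField.mlieBracket (𝓡 8) X Z x) (Y x)
    - inner ℝ (VectorField.mlieBracket (𝓡 8) Y Z x) (X x)

/-- The Levi-Civita covariant derivative `∇_v Y` at `x`, defined by the Koszul formula. -/
def leviCivita (Y : Π y : M, TangentSpace (𝓡 8) y) (x : M) (v : TangentSpace (𝓡 8) x) :
    TangentSpace (𝓡 8) x :=
  (1 / 2 : ℝ) • ∑ j, koszul (extend E8 v) Y
    (extend E8 (stdOrthonormalBasis ℝ (TangentSpace (𝓡 8) x) j)) x •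
      stdOrthonormalBasis ℝ (TangentSpace (𝓡 8) x) j

section TwistedDirac

variable {FE : Type*} [NormedAddCommGroup FE] [NormedSpace ℝ FE]
  {E : M → Type*} [TopologicalSpace (TotalSpace FE E)]
  [∀ x, AddCommGroup (E x)] [∀ x, Module ℝ (E x)] [∀ x, TopologicalSpace (E x)]
  [∀ x, IsTopologicalAddGroup (E x)] [∀ x, ContinuousSMul ℝ (E x)]
  [FiberBundle FE E] [VectorBundle ℝ FE E]

/-- The codifferential `d_A^* τ = -∑ᵢ (∇_{e_i} τ)(e_i)`, where `∇` is the connection on `T^*M ⊗ E`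
induced by the Levi-Civita connection and `∇_A`:
`(∇_v τ)(Y) = ∇_{A,v}(τ(Y)) - τ(∇_v Y)`. -/
def codifferential (A : CovariantDerivative (𝓡 8) FE E) (τ : OneForms FE E) (x : M) : E x :=
  -∑ i, (A (fun y => τ y (extend E8 (stdOrthonormalBasis ℝ (TangentSpace (𝓡 8) x) i) y)) x
        (stdOrthonormalBasis ℝ (TangentSpace (𝓡 8) x) i)
      - τ x (leviCivita (extend E8 (stdOrthonormalBasis ℝ (TangentSpace (𝓡 8) x) i)) x
        (stdOrthonormalBasis ℝ (TangentSpace (𝓡 8) x) i)))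

/-- `ι_τ T = ∑ᵢ T(e_i, ·, ·) ⊗ τ(e_i)`, the contraction of a `3`-form with an `E`-valued
one-form (through the metric) in the first argument. -/
def contractOneForm {x : M} (T : TangentSpace (𝓡 8) x [⋀^Fin 3]→ₗ[ℝ] ℝ)
    (τ : TangentSpace (𝓡 8) x →L[ℝ] E x) : TangentSpace (𝓡 8) x [⋀^Fin 2]→ₗ[ℝ] E x :=
  ∑ i, formTensor (T.curryLeft (stdOrthonormalBasis ℝ (TangentSpace (𝓡 8) x) i))
    (τ (stdOrthonormalBasis ℝ (TangentSpace (𝓡 8) x) i))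

/-! ### The twisted Dirac operator -/

variable {FS : Type*} [NormedAddCommGroup FS] [NormedSpace ℝ FS]
  {S : M → Type*} [TopologicalSpace (TotalSpace FS S)]
  [∀ x, NormedAddCommGroup (S x)] [∀ x, InnerProductSpace ℝ (S x)]
  [FiberBundle FS S] [VectorBundle ℝ FS S] [FiniteDimensional ℝ FS]

/-- The covariant derivative `∇_v Ψ` of a section `Ψ` of `S ⊗ E` at `x` for the tensor product
connection `∇_S ⊗ 1 + 1 ⊗ ∇_A`. With a local frame `(s_a)` of `S` near `x` and its dual frame
`(φ_a)` one has `Ψ = ∑_a s_a ⊗ ε_a`, where `ε_a = (φ_a ⊗ id)(Ψ)`, and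
`∇_v Ψ = ∑_a (∇_v s_a ⊗ ε_a + s_a ⊗ ∇_v ε_a)`. -/
def tensorDerivative (D : CovariantDerivative (𝓡 8) FS S) (A : CovariantDerivative (𝓡 8) FE E)
    (Ψ : Π y : M, S y ⊗[ℝ] E y) (x : M) (v : TangentSpace (𝓡 8) x) : S x ⊗[ℝ] E x :=
  let t := trivializationAt FS S x
  let b := finBasis ℝ FS
  let s (a : Fin (finrank ℝ FS)) (y : M) : S y := t.symm y (b a)
  let φ (a : Fin (finrank ℝ FS)) (y : M) : S y →ₗ[ℝ] ℝ := b.coord a ∘ₗ t.linearMapAt ℝ y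
  let ε (a : Fin (finrank ℝ FS)) (y : M) : E y :=
    TensorProduct.lid ℝ (E y) ((φ a y).rTensor (E y) (Ψ y))
  ∑ a, (D (s a) x v ⊗ₜ[ℝ] ε a x + s a x ⊗ₜ[ℝ] A (ε a) x v)

/-- The twisted Dirac operator `Ψ ↦ ∑ᵢ e_i · ∇_{e_i} Ψ` on sections of `S ⊗ E`, for the connection
`∇_S ⊗ 1 + 1 ⊗ ∇_A`. -/
def dirac (c : SpinorStructure FS S) (D : CovariantDerivative (𝓡 8) FS S)
    (A : CovariantDerivative (𝓡 8) FE E) (Ψ : Π y : M, S y ⊗[ℝ] E y) (x : M) : S x ⊗[ℝ] E x :=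
  ∑ i, (c.clifford x (stdOrthonormalBasis ℝ (TangentSpace (𝓡 8) x) i)).toLinearMap.rTensor (E x)
    (tensorDerivative D A Ψ x (stdOrthonormalBasis ℝ (TangentSpace (𝓡 8) x) i))

/-- The subspace `S^± ⊗ E` of `S ⊗ E` at `x` (`S⁺` for `ε = 1`, `S⁻` for `ε = -1`). -/
def chiralTwisted (Ω : Spin7Structure M) (c : SpinorStructure FS S) (E : M → Type*)
    [∀ x, AddCommGroup (E x)] [∀ x, Module ℝ (E x)] (ε : ℝ) (x : M) :
    Submodule ℝ (S x ⊗[ℝ] E x) :=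
  LinearMap.range ((chiralSpinors Ω c ε x).subtype.rTensor (E x))

/-- The map `Λ¹ ⊗ E → S ⊗ E`, `τ ↦ τ · η = ∑ᵢ (e_i · η) ⊗ τ(e_i)`, at the point `x`. -/
def oneFormToSpinor (c : SpinorStructure FS S) (η : Π y : M, S y) (E : M → Type*)
    [∀ x, AddCommGroup (E x)] [∀ x, Module ℝ (E x)] [∀ x, TopologicalSpace (E x)]
    [∀ x, IsTopologicalAddGroup (E x)] [∀ x, ContinuousSMul ℝ (E x)] (x : M) :
    (TangentSpace (𝓡 8) x →L[ℝ] E x) →ₗ[ℝ] S x ⊗[ℝ] E x where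
  toFun τ := ∑ i, c.clifford x (stdOrthonormalBasis ℝ (TangentSpace (𝓡 8) x) i) (η x) ⊗ₜ[ℝ]
    τ (stdOrthonormalBasis ℝ (TangentSpace (𝓡 8) x) i)
  map_add' τ τ' := by
    simp [TensorProduct.tmul_add, Finset.sum_add_distrib]
  map_smul' r τ := by
    simp [TensorProduct.tmul_smul, Finset.smul_sum]

/-- The map `(Λ⁰ ⊕ Λ²) ⊗ E → S ⊗ E`, `(f, α) ↦ f η + α · η` at the point `x`, where
`f η = η ⊗ f` and `α · η = ∑_{i<j} (e_i · e_j · η) ⊗ α(e_i, e_j)`. -/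
def evenFormToSpinor (c : SpinorStructure FS S) (η : Π y : M, S y) (E : M → Type*)
    [∀ x, AddCommGroup (E x)] [∀ x, Module ℝ (E x)] (x : M) :
    (E x × (TangentSpace (𝓡 8) x [⋀^Fin 2]→ₗ[ℝ] E x)) →ₗ[ℝ] S x ⊗[ℝ] E x where
  toFun p := η x ⊗ₜ[ℝ] p.1 + (1 / 2 : ℝ) • ∑ i, ∑ j,
    c.clifford x (stdOrthonormalBasis ℝ (TangentSpace (𝓡 8) x) i)
      (c.clifford x (stdOrthonormalBasis ℝ (TangentSpace (𝓡 8) x) j) (η x)) ⊗ₜ[ℝ]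
        p.2 ![stdOrthonormalBasis ℝ (TangentSpace (𝓡 8) x) i,
          stdOrthonormalBasis ℝ (TangentSpace (𝓡 8) x) j]
  map_add' p q := by
    simp only [Prod.fst_add, Prod.snd_add, AlternatingMap.add_apply, TensorProduct.tmul_add,
      Finset.sum_add_distrib, smul_add]
    abel
  map_smul' r p := by
    simp only [Prod.smul_fst, Prod.smul_snd, AlternatingMap.smul_apply, TensorProduct.tmul_smul,
      ← Finset.smul_sum, smul_add, RingHom.id_apply]
    rw [smul_comm]

/-- The fibre of `(Λ⁰ ⊕ Λ²_7) ⊗ E` at `x`. -/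
def evenForms (Ω : Spin7Structure M) (E : M → Type*)
    [∀ x, AddCommGroup (E x)] [∀ x, Module ℝ (E x)] (x : M) :
    Submodule ℝ (E x × (TangentSpace (𝓡 8) x [⋀^Fin 2]→ₗ[ℝ] E x)) :=
  Submodule.prod ⊤ (Lambda27 (Ω.orientation x) (Ω.form x) (E x))

end TwistedDirac

end Manifold

end Spin7

end

/-! Everything except the Leibniz rule is linear algebra in a fibre, driven by the unit positive
spinor `η`. Since `v ↦ v·η` is isometric, the eight spinors `e_i·η` are orthonormal in S⁻.
Multiplying them by one fixed `e_{i₀}` gives eight orthonormal spinors in S⁺, and rank 16 forces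
both families to be bases. This is the isomorphism Λ¹ ≅ S⁻ (`oneForm_isomorphism`).

For S⁺, the defining relation between `Ω` and `η` gives ⟨e_k·e_l·η, e_i·e_j·η⟩ = δ_{ik}δ_{jl} −
δ_{il}δ_{jk} + Ω_{ijkl} for i ≠ j and k ≠ l (`inner_two_two`). The volume element fixes `η`, so `Ω`
is self-dual (`form_mul_volume`) and ⋆(α∧Ω)_{kl} = ½ ∑ Ω_{ijkl} α_{ij} (`hodgeStar_wedge`). Pairing
α·η with e_k·e_l·η therefore yields the components of α + ⋆(α∧Ω), which is 4α on Λ²_7; this gives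
injectivity. Conversely, for s ∈ S⁺ orthogonal to `η`, the 2-form ⟨u·v·η, s⟩ acts on `η` to give 4s,
so it lies in Λ²_7; this gives surjectivity. The same form describes the adjoint of β ↦ β·η, so
forms orthogonal to Λ²_7 annihilate `η`, and projecting by π₇ does not change α·η
(`cliffordTwo_pi7`).

For the Dirac operator, ∇ᵀη = 0 and metricity give ∇_v(τ·η) = (∇_vτ)·η
(`tensorDerivative_oneFormToSpinor`). Clifford-multiplying by e_i and summing splits ∇τ into minus
its trace and its antisymmetrization (`sum_rTensor_eq`). The trace part is d_A^*τ, because totally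
antisymmetric torsion does not affect ∇_v v (`leviCivita_self`). The antisymmetrization is d_Aτ
minus τ of the torsion, that is d_Aτ − ι_τT, and π₇ may then be inserted for free. -/

noncomputable section

namespace Spin7

/-! ### Clifford relations and the volume element -/

section Clifford

variable {V : Type*} [NormedAddCommGroup V] [InnerProductSpace ℝ V]
  {S : Type*} [NormedAddCommGroup S] [InnerProductSpace ℝ S]

/-- An orthogonal action of the Clifford algebra of `V` (with `v · v = -|v|²`) on `S`. -/
structure IsCliffordAction (c : V →L[ℝ] S →L[ℝ] S) : Prop where
  sq : ∀ (v : V) (s : S), c v (c v s) = -(‖v‖ ^ 2) • s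
  skew : ∀ (v : V) (s t : S), inner ℝ (c v s) t = -inner ℝ s (c v t)

variable {c : V →L[ℝ] S →L[ℝ] S}

namespace IsCliffordAction

/-- Polarization of `sq` at `u + v`. -/
theorem anticomm (hc : IsCliffordAction c) (u v : V) (s : S) :
    c u (c v s) = -c v (c u s) - (2 * inner ℝ u v) • s := by
  have h := hc.sq (u + v) s
  simp only [map_add, add_apply, hc.sq, norm_add_sq_real u v] at h
  rw [← sub_eq_zero] at h ⊢
  rw [← h]
  module

theorem anticomm_of_orthogonal (hc : IsCliffordAction c) {u v : V} (h : inner ℝ u v = (0 : ℝ))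
    (s : S) : c u (c v s) = -c v (c u s) := by
  rw [hc.anticomm u v, h]
  simp

theorem inner_apply_apply (hc : IsCliffordAction c) (v : V) (s t : S) :
    inner ℝ (c v s) (c v t) = ‖v‖ ^ 2 * inner ℝ s t := by
  rw [hc.skew, hc.sq, inner_smul_right]
  ring

/-- `⟨u · s, v · s⟩ = ⟨u, v⟩ |s|²`. -/
theorem inner_apply_eq (hc : IsCliffordAction c) (u v : V) (s : S) :
    inner ℝ (c u s) (c v s) = inner ℝ u v * ‖s‖ ^ 2 := by
  have h1 : inner ℝ (c u s) (c v s) = -inner ℝ s (c u (c v s)) := hc.skew u s _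
  have h2 : inner ℝ (c v s) (c u s) = -inner ℝ s (c v (c u s)) := hc.skew v s _
  rw [hc.anticomm u v, inner_sub_right, inner_neg_right, inner_smul_right,
    real_inner_self_eq_norm_sq] at h1
  rw [real_inner_comm] at h2
  linarith

theorem inner_two (hc : IsCliffordAction c) (u v : V) (s t : S) :
    inner ℝ (c u (c v s)) t = inner ℝ s (c v (c u t)) := by
  rw [hc.skew, hc.skew, neg_neg]

/-- `⟨s, u · v · s⟩ = 0` for orthogonal `u`, `v`. -/
theorem inner_two_self (hc : IsCliffordAction c) {u v : V} (h : inner ℝ u v = (0 : ℝ)) (s : S) :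
    inner ℝ s (c u (c v s)) = (0 : ℝ) := by
  have h1 := hc.inner_two u v s s
  rw [hc.anticomm_of_orthogonal (real_inner_comm u v ▸ h : inner ℝ v u = (0 : ℝ)), real_inner_comm,
    inner_neg_right] at h1
  linarith

end IsCliffordAction

/-- Commuting `v` through a Clifford product of vectors, each of which commutes with `v` up to a
scalar. -/
theorem apply_list_prod {R A : Type*} [CommRing R] [Ring A] [Algebra R A] {ι : Type*} (a : A)
    (x : ι → A) (r : ι → R) (h : ∀ i, a * x i = r i • (x i * a)) (l : List ι) :
    a * (l.map x).prod = (l.map r).prod • ((l.map x).prod * a) := by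
  induction l with
  | nil => simp
  | cons i l ih =>
    simp only [List.map_cons, List.prod_cons]
    rw [← mul_assoc, h i, smul_mul_assoc, mul_assoc, ih, mul_smul_comm, smul_smul, mul_assoc]

/-- A basis vector commutes with itself and anticommutes with the other seven, so passing it through
the volume element costs (−1)⁷; linearity extends this to all `v`. -/
theorem IsCliffordAction.volume_anticomm (hc : IsCliffordAction c)
    (b : OrthonormalBasis (Fin 8) ℝ V) (v : V) (s : S) :
    (List.ofFn fun i => c (b i)).prod (c v s) = -c v ((List.ofFn fun i => c (b i)).prod s) := by
  have hb (i : Fin 8) : c (b i) * (List.ofFn fun j => c (b j)).prod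
      = (-1 : ℝ) • ((List.ofFn fun j => c (b j)).prod * c (b i)) := by
    have h := apply_list_prod (R := ℝ) (c (b i)) (fun j => c (b j))
      (fun j => if j = i then 1 else -1) (fun j => ?_) (List.finRange 8)
    · rw [List.ofFn_eq_map, h]
      congr 1
      rw [← List.ofFn_eq_map, List.prod_ofFn]
      rw [Finset.prod_ite]
      simp [Finset.filter_ne']
      norm_num
    · ext s
      split_ifs with hij
      · simp [hij]
      · have := hc.anticomm_of_orthogonal (b.orthonormal.2 (Ne.symm hij)) s
        simpa using this
  set P := (List.ofFn fun i => c (b i)).prod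
  have hb' (i : Fin 8) : P (c (b i) s) = -c (b i) (P s) := by
    have := congrArg (fun f : S →L[ℝ] S => f s) (hb i)
    simp only [mul_apply_eq_comp, neg_smul, one_smul, neg_apply] at this
    rw [this, neg_neg]
  rw [← b.sum_repr v]
  simp only [map_sum, map_smul, sum_apply, smul_apply, hb', smul_neg, Finset.sum_neg_distrib]

theorem IsCliffordAction.inner_volume (hc : IsCliffordAction c)
    (b : OrthonormalBasis (Fin 8) ℝ V) (s t : S) :
    inner ℝ ((List.ofFn fun i => c (b i)).prod s) ((List.ofFn fun i => c (b i)).prod t)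
      = inner ℝ s t := by
  simp [List.ofFn_succ, hc.inner_apply_apply]

end Clifford

/-- The four entries of `g` must order the four indices outside `{i, j, k, l}`, which leaves 4!
choices. This is the multiplicity in the Hodge star computation. -/
theorem card_injective_append {ι : Type*} [Fintype ι] [DecidableEq ι] (hι : Fintype.card ι = 8)
    {i j k l : ι} (h : Function.Injective ![i, j, k, l]) :
    Fintype.card {g : Fin 4 → ι // Function.Injective ![i, j, g 0, g 1, g 2, g 3, k, l]} = 24 := by
  have key (g : Fin 4 → ι) : Function.Injective ![i, j, g 0, g 1, g 2, g 3, k, l] ↔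
      Function.Injective g ∧ ∀ t, g t ∉ ({i, j, k, l} : Finset ι) := by
    rw [← List.nodup_ofFn] at h
    rw [← List.nodup_ofFn, ← List.nodup_ofFn]
    simp [List.ofFn_succ, Fin.forall_fin_succ] at h ⊢
    grind
  have hcompl : Fintype.card {m : ι // m ∉ ({i, j, k, l} : Finset ι)} = 4 := by
    have : ({i, j, k, l} : Finset ι).card = 4 := by
      rw [← List.nodup_ofFn] at h
      have := List.toFinset_card_of_nodup h
      simpa [List.ofFn_succ] using this
    rw [Fintype.card_subtype_compl, hι, Fintype.card_coe, this]
  let F : {g : Fin 4 → ι // Function.Injective ![i, j, g 0, g 1, g 2, g 3, k, l]} ≃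
      (Fin 4 ↪ {m : ι // m ∉ ({i, j, k, l} : Finset ι)}) :=
    { toFun := fun g => ⟨fun t => ⟨g.1 t, ((key _).mp g.2).2 t⟩, fun a b hab =>
        ((key _).mp g.2).1 (congrArg Subtype.val hab)⟩
      invFun := fun f => ⟨fun t => (f t).1, (key _).mpr
        ⟨fun a b hab => f.injective (Subtype.ext hab), fun t => (f t).2⟩⟩
      left_inv := fun g => rfl
      right_inv := fun f => rfl }
  rw [Fintype.card_congr F, Fintype.card_embedding_eq, hcompl]
  rfl

/-! ### Chirality, the spinor bases of S⁻ and S⁺, and self-duality of `Ω` -/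

section Chirality

variable {V : Type*} [NormedAddCommGroup V] [InnerProductSpace ℝ V]
  {S : Type*} [NormedAddCommGroup S] [InnerProductSpace ℝ S]

/-- The spinors on which the volume element of `V` acts by the scalar `ε`. -/
def chiral (o : Orientation ℝ V (Fin 8)) (c : V →L[ℝ] S →L[ℝ] S) (ε : ℝ) : Submodule ℝ S where
  carrier := {s | ∀ b : OrthonormalBasis (Fin 8) ℝ V, b.toBasis.orientation = o →
    (List.ofFn fun i => c (b i)).prod s = ε • s}
  add_mem' hs ht b hb := by rw [map_add, hs b hb, ht b hb, smul_add]
  zero_mem' b hb := by rw [map_zero, smul_zero]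
  smul_mem' r s hs b hb := by rw [map_smul, hs b hb, smul_comm]

variable {o : Orientation ℝ V (Fin 8)} {c : V →L[ℝ] S →L[ℝ] S}

theorem IsCliffordAction.apply_mem_chiral (hc : IsCliffordAction c) {ε : ℝ} {s : S}
    (hs : s ∈ chiral o c ε) (v : V) : c v s ∈ chiral o c (-ε) := by
  intro b hb
  rw [hc.volume_anticomm, hs b hb, map_smul, neg_smul]

theorem IsCliffordAction.apply_mem_chiral_neg_one (hc : IsCliffordAction c) {s : S}
    (hs : s ∈ chiral o c 1) (v : V) : c v s ∈ chiral o c (-1) :=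
  hc.apply_mem_chiral hs v

theorem IsCliffordAction.apply_mem_chiral_one (hc : IsCliffordAction c) {s : S}
    (hs : s ∈ chiral o c (-1)) (v : V) : c v s ∈ chiral o c 1 := by
  simpa using hc.apply_mem_chiral hs v

/-- The unit spinor defining a `4`-form `Ω` on an oriented Euclidean `8`-space. -/
structure IsCayleySpinor (o : Orientation ℝ V (Fin 8)) (Ω : V [⋀^Fin 4]→ₗ[ℝ] ℝ)
    (c : V →L[ℝ] S →L[ℝ] S) (η : S) : Prop where
  action : IsCliffordAction c
  rank_eq : finrank ℝ S = 16
  norm_eq : ‖η‖ = 1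
  positive : η ∈ chiral o c 1
  form_eq : ∀ u : Fin 4 → V, Orthonormal ℝ u →
    Ω u = -inner ℝ (c (u 0) (c (u 1) (c (u 2) (c (u 3) η)))) η

namespace IsCayleySpinor

variable {Ω : V [⋀^Fin 4]→ₗ[ℝ] ℝ} {η : S}

theorem inner_apply (h : IsCayleySpinor o Ω c η) (u v : V) :
    inner ℝ (c u η) (c v η) = inner ℝ u v := by
  rw [h.action.inner_apply_eq, h.norm_eq]
  ring

theorem inner_apply_basis {ι : Type*} [Fintype ι] [DecidableEq ι] (h : IsCayleySpinor o Ω c η)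
    (e : OrthonormalBasis ι ℝ V) (i j : ι) :
    inner ℝ (c (e i) η) (c (e j) η) = if i = j then (1 : ℝ) else 0 := by
  rw [h.inner_apply, orthonormal_iff_ite.mp e.orthonormal]

end IsCayleySpinor

theorem _root_.OrthonormalBasis.toBasis_det_self (b : OrthonormalBasis (Fin 8) ℝ V) :
    b.toBasis.det b = 1 := by
  rw [← b.coe_toBasis, b.toBasis.det_self]

variable [Fact (finrank ℝ V = 8)]

/-- The volume element is an isometry acting by 1 on `s` and by −1 on `t`, so ⟨s, t⟩ = −⟨s, t⟩. -/
theorem IsCliffordAction.inner_chiral (hc : IsCliffordAction c) {s t : S}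
    (hs : s ∈ chiral o c 1) (ht : t ∈ chiral o c (-1)) : inner ℝ s t = (0 : ℝ) := by
  have hb := o.finOrthonormalBasis_orientation (by norm_num) (Fact.out : finrank ℝ V = 8)
  have h := hc.inner_volume (o.finOrthonormalBasis (by norm_num) (Fact.out : finrank ℝ V = 8)) s t
  rw [hs _ hb, ht _ hb] at h
  simp only [one_smul, neg_smul, inner_neg_right] at h
  linarith

/-- An orthonormal basis acts on a positive spinor by its volume. -/
theorem IsCliffordAction.volume_apply (hc : IsCliffordAction c) {η : S} (hη : η ∈ chiral o c 1)
    (b : OrthonormalBasis (Fin 8) ℝ V) :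
    (List.ofFn fun i => c (b i)).prod η = o.volumeForm b • η := by
  by_cases hb : b.toBasis.orientation = o
  · rw [hη b hb, o.volumeForm_robust b hb, b.toBasis_det_self]
  · have hvol : o.volumeForm b = -1 := by
      rw [o.volumeForm_robust_neg b hb, AlternatingMap.neg_apply, b.toBasis_det_self]
    -- Chirality only speaks of oriented bases; exchanging two vectors makes `b` oriented, at the
    -- cost of one sign in the Clifford product and one in the volume.
    set b' := b.reindex (Equiv.swap 0 1) with hb'
    have hvol' : o.volumeForm b' = 1 := by
      have : (b' : Fin 8 → V) = b ∘ Equiv.swap (0 : Fin 8) 1 := by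
        ext i; simp [hb']
      rw [this, AlternatingMap.map_swap _ _ (by decide), hvol, neg_neg]
    have ho : b'.toBasis.orientation = o := by
      by_contra h
      rw [o.volumeForm_robust_neg b' h, AlternatingMap.neg_apply, b'.toBasis_det_self] at hvol'
      norm_num at hvol'
    have h := hη b' ho
    rw [one_smul] at h
    suffices H : (List.ofFn fun i => c (b i)).prod η = -(List.ofFn fun i => c (b' i)).prod η by
      rw [hvol, H, h, neg_one_smul]
    have h01 : inner ℝ (b 0) (b 1) = (0 : ℝ) := b.orthonormal.2 (by decide)
    have hs (i : Fin 6) : b' i.succ.succ = b i.succ.succ := by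
      rw [hb', OrthonormalBasis.reindex_apply, Equiv.symm_swap, Equiv.swap_apply_of_ne_of_ne]
      · exact Fin.succ_ne_zero _
      · exact fun h => Fin.succ_ne_zero _ (Fin.succ_injective _ h)
    have h0 : b' 0 = b 1 := by simp [hb']
    have h1 : b' 1 = b 0 := by simp [hb']
    rw [List.ofFn_succ, List.ofFn_succ, List.ofFn_succ (f := fun i => c (b' i)),
      List.ofFn_succ (f := fun i : Fin 7 => c (b' i.succ))]
    simp only [List.prod_cons, hs]
    rw [h0, Fin.succ_zero_eq_one, h1]
    simp only [mul_apply_eq_comp]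
    rw [hc.anticomm_of_orthogonal h01]

namespace IsCayleySpinor

variable {Ω : V [⋀^Fin 4]→ₗ[ℝ] ℝ} {η : S} {ι : Type*} [Fintype ι]

theorem card_eq (e : OrthonormalBasis ι ℝ V) : Fintype.card ι = 8 := by
  rw [← finrank_eq_card_basis e.toBasis]
  exact Fact.out

/-- The spinors `e_i · η` form an orthonormal basis of `S⁻`. -/
theorem sum_inner_smul_of_mem_neg (h : IsCayleySpinor o Ω c η) (e : OrthonormalBasis ι ℝ V)
    {s : S} (hs : s ∈ chiral o c (-1)) :
    ∑ i, inner ℝ (c (e i) η) s • c (e i) η = s := by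
  classical
  have hcard := card_eq e
  obtain ⟨i₀⟩ : Nonempty ι := Fintype.card_pos_iff.mp (by omega)
  have hmem (i : ι) : c (e i) η ∈ chiral o c (-1) :=
    h.action.apply_mem_chiral_neg_one h.positive _
  have hmem' (i : ι) : c (e i₀) (c (e i) η) ∈ chiral o c 1 :=
    h.action.apply_mem_chiral_one (hmem i) _
  -- Eight spinors in S⁻ and eight in S⁺, together 16 orthonormal vectors in a space of dimension
  -- 16. On a negative `s` only the first half contributes.
  let F : ι ⊕ ι → S := Sum.elim (fun i => c (e i) η) fun i => c (e i₀) (c (e i) η)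
  have hF : Orthonormal ℝ F := by
    rw [orthonormal_iff_ite]
    rintro (i | i) (j | j)
    · simp [F, h.inner_apply_basis]
    · simp only [F, Sum.elim_inl, Sum.elim_inr, reduceCtorEq, if_false]
      rw [real_inner_comm]
      exact h.action.inner_chiral (hmem' j) (hmem i)
    · simp only [F, Sum.elim_inl, Sum.elim_inr, reduceCtorEq, if_false]
      exact h.action.inner_chiral (hmem' i) (hmem j)
    · simp [F, h.action.inner_apply_apply, h.inner_apply_basis]
  have : Nonempty (ι ⊕ ι) := ⟨.inl i₀⟩
  let B : OrthonormalBasis (ι ⊕ ι) ℝ S :=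
    (basisOfOrthonormalOfCardEqFinrank hF
      (by rw [Fintype.card_sum, hcard, h.rank_eq])).toOrthonormalBasis (by simpa using hF)
  have hB : (B : ι ⊕ ι → S) = F := by simp [B]
  have hsum := B.sum_repr' s
  rw [Fintype.sum_sum_type] at hsum
  simp only [hB] at hsum
  have h0 : ∑ i, inner ℝ (F (.inr i)) s • F (.inr i) = 0 :=
    Finset.sum_eq_zero fun i _ => by
      rw [show inner ℝ (F (.inr i)) s = (0 : ℝ) from h.action.inner_chiral (hmem' i) hs, zero_smul]
  rwa [h0, add_zero] at hsum

/-- Multiplication by `v` sends `s` into S⁻, where the expansion in the `e_j·η` is available;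
multiplying by `v` again returns to S⁺ with the factor −|v|². -/
theorem sum_inner_smul_of_mem_pos (h : IsCayleySpinor o Ω c η) (e : OrthonormalBasis ι ℝ V)
    {s : S} (hs : s ∈ chiral o c 1) (v : V) :
    ∑ j, inner ℝ (c v (c (e j) η)) s • c v (c (e j) η) = ‖v‖ ^ 2 • s := by
  have h1 := congrArg (c v) (h.sum_inner_smul_of_mem_neg e
    (h.action.apply_mem_chiral_neg_one hs v))
  rw [map_sum, h.action.sq] at h1
  simp only [map_smul] at h1
  rw [← neg_inj, ← neg_smul, ← h1, ← Finset.sum_neg_distrib]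
  refine Finset.sum_congr rfl fun j _ => ?_
  rw [h.action.skew, neg_smul, neg_neg]

theorem sum_sum_inner_smul (h : IsCayleySpinor o Ω c η) (e : OrthonormalBasis ι ℝ V)
    {s : S} (hs : s ∈ chiral o c 1) :
    ∑ i, ∑ j, inner ℝ (c (e i) (c (e j) η)) s • c (e i) (c (e j) η) = (8 : ℝ) • s := by
  simp only [h.sum_inner_smul_of_mem_pos e hs]
  simp [card_eq e]
  rw [← Nat.cast_smul_eq_nsmul ℝ]
  norm_num

/-- `Ω` is self-dual. -/
theorem form_mul_volume (h : IsCayleySpinor o Ω c η) (e : OrthonormalBasis ι ℝ V)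
    {i j p q r s k l : ι} (hinj : Function.Injective ![i, j, p, q, r, s, k, l]) :
    Ω ![e p, e q, e r, e s] * o.volumeForm ![e i, e j, e p, e q, e r, e s, e k, e l]
      = Ω ![e i, e j, e k, e l] := by
  set f := ![i, j, p, q, r, s, k, l] with hf
  have hcard := card_eq e
  have hbij : Function.Bijective f :=
    (Fintype.bijective_iff_injective_and_card f).mpr ⟨hinj, by simp [hcard]⟩
  let b : OrthonormalBasis (Fin 8) ℝ V := e.reindex (Equiv.ofBijective f hbij).symm
  have hb : (b : Fin 8 → V) = ![e i, e j, e p, e q, e r, e s, e k, e l] := by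
    ext t; fin_cases t <;> simp [b, hf]
  have hvol := h.action.volume_apply h.positive b
  rw [hb] at hvol
  set ε := o.volumeForm ![e i, e j, e p, e q, e r, e s, e k, e l] with hε
  -- The volume of an orthonormal basis is ±1; the sign records the ordering of the eight indices.
  have hε2 : ε * ε = 1 := by
    have := o.abs_volumeForm_apply_of_orthonormal b
    rw [hb, ← hε] at this
    rw [← abs_mul_abs_self, this, one_mul]
  have hne (m n : Fin 8) (hmn : m ≠ n) (t : S) : c (e (f m)) (c (e (f n)) t)
      = -c (e (f n)) (c (e (f m)) t) :=
    h.action.anticomm_of_orthogonal (e.orthonormal.2 fun hh => hmn (hinj hh)) t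
  have hsq (m : ι) (t : S) : c (e m) (c (e m) t) = -t := by simp [h.action.sq]
  have horth (g : Fin 4 → Fin 8) (hg : Function.Injective g) :
      Orthonormal ℝ fun t => e (f (g t)) :=
    e.orthonormal.comp _ (hinj.comp hg)
  have h1 := h.form_eq _ (horth ![2, 3, 4, 5] (by decide))
  have h2 := h.form_eq _ (horth ![0, 1, 6, 7] (by decide))
  have v1 : (fun t => e (f (![2, 3, 4, 5] t))) = ![e p, e q, e r, e s] := by
    ext t; fin_cases t <;> rfl
  have v2 : (fun t => e (f (![0, 1, 6, 7] t))) = ![e i, e j, e k, e l] := by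
    ext t; fin_cases t <;> rfl
  rw [v1] at h1
  rw [v2] at h2
  rw [h1, h2]
  set A : Fin 8 → S → S := fun m t => c (e (f m)) t with hA
  have hvol' : A 0 (A 1 (A 2 (A 3 (A 4 (A 5 (A 6 (A 7 η))))))) = ε • η := by
    rw [← hvol]
    simp [hA, List.ofFn_succ]
    rfl
  -- A product of two basis vectors commutes with any third one, so the last two factors can be
  -- brought next to the first two without sign.
  have hcomm (m : Fin 8) (h6 : m ≠ 6) (h7 : m ≠ 7) (t : S) :
      A m (A 6 (A 7 t)) = A 6 (A 7 (A m t)) := by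
    simp only [hA]
    rw [hne m 6 h6, hne m 7 h7, map_neg, neg_neg]
  rw [hcomm 5 (by decide) (by decide), hcomm 4 (by decide) (by decide),
    hcomm 3 (by decide) (by decide), hcomm 2 (by decide) (by decide)] at hvol'
  -- Cancelling the four leading factors produces four signs −1, and the inverse product appears in
  -- reverse order; reversing four anticommuting factors takes six transpositions, so no sign
  -- survives.
  have hX : A 2 (A 3 (A 4 (A 5 η))) = ε • A 0 (A 1 (A 6 (A 7 η))) := by
    have h3 := congrArg (fun t => A 7 (A 6 (A 1 (A 0 t)))) hvol'
    simp only [hA, hsq, map_neg, neg_neg, map_smul] at h3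
    simp only [hA]
    rw [h3, hne 1 0 (by decide)]
    simp only [map_neg]
    rw [hne 6 0 (by decide), hne 6 1 (by decide)]
    simp only [map_neg]
    rw [hne 7 0 (by decide), hne 7 1 (by decide), hne 7 6 (by decide)]
    simp only [map_neg, neg_neg]
  have e1 : inner ℝ (A 2 (A 3 (A 4 (A 5 η)))) η = ε * inner ℝ (A 0 (A 1 (A 6 (A 7 η)))) η := by
    rw [hX, inner_smul_left]
    rfl
  change -inner ℝ (A 2 (A 3 (A 4 (A 5 η)))) η * ε = -inner ℝ (A 0 (A 1 (A 6 (A 7 η)))) η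
  rw [e1]
  linear_combination (-inner ℝ (A 0 (A 1 (A 6 (A 7 η)))) η) * hε2

/-- Only those `g` that complete i, j, k, l to a permutation of all eight indices contribute; by
self-duality each contributes the same value, and there are 24 of them. -/
theorem sum_form_mul_volume (h : IsCayleySpinor o Ω c η) (e : OrthonormalBasis ι ℝ V) (i j k l : ι) :
    ∑ g : Fin 4 → ι, Ω (fun t => e (g t)) *
        o.volumeForm ![e i, e j, e (g 0), e (g 1), e (g 2), e (g 3), e k, e l]
      = 24 * Ω ![e i, e j, e k, e l] := by
  classical
  have hvec (g : Fin 4 → ι) : ![e i, e j, e (g 0), e (g 1), e (g 2), e (g 3), e k, e l]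
      = e ∘ ![i, j, g 0, g 1, g 2, g 3, k, l] := by
    ext t; fin_cases t <;> rfl
  have hvec4 : ![e i, e j, e k, e l] = e ∘ ![i, j, k, l] := by
    ext t; fin_cases t <;> rfl
  have hg4 (g : Fin 4 → ι) : (fun t => e (g t)) = ![e (g 0), e (g 1), e (g 2), e (g 3)] := by
    ext t; fin_cases t <;> rfl
  have hterm (g : Fin 4 → ι) : Ω (fun t => e (g t)) *
        o.volumeForm ![e i, e j, e (g 0), e (g 1), e (g 2), e (g 3), e k, e l]
      = if Function.Injective ![i, j, g 0, g 1, g 2, g 3, k, l]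
        then Ω ![e i, e j, e k, e l] else 0 := by
    split_ifs with hg
    · rw [hg4]
      exact h.form_mul_volume e hg
    · rw [hvec, AlternatingMap.map_eq_zero_of_not_injective _ _ fun hh =>
        hg hh.of_comp, mul_zero]
  simp only [hterm]
  by_cases hd : Function.Injective ![i, j, k, l]
  · rw [← Finset.sum_filter, Finset.sum_const, ← Fintype.card_subtype,
      card_injective_append (card_eq e) hd]
    simp
  · rw [hvec4, AlternatingMap.map_eq_zero_of_not_injective _ _ fun hh => hd hh.of_comp]
    simp

end IsCayleySpinor

end Chirality

/-! ### The operator α ↦ ⋆(α ∧ Ω) in components -/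

section HodgeWedge

section Forms

variable {V : Type*} [AddCommGroup V] [Module ℝ V] {W : Type*} [AddCommGroup W] [Module ℝ W]

theorem alternatingMap_sum_apply {ι κ : Type*} (s : Finset κ) (f : κ → V [⋀^ι]→ₗ[ℝ] W)
    (v : ι → V) : (∑ i ∈ s, f i) v = ∑ i ∈ s, f i v :=
  map_sum (⟨⟨fun g : V [⋀^ι]→ₗ[ℝ] W => g v, rfl⟩, fun _ _ => rfl⟩ : (V [⋀^ι]→ₗ[ℝ] W) →+ W) f s

/-- A sum over all permutations counts each shuffle p!·q! times, since `α` and `β` absorb the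
permutations within their blocks. This avoids choosing shuffle representatives. -/
theorem factorial_smul_wedge_apply {p q : ℕ} (α : V [⋀^Fin p]→ₗ[ℝ] W) (β : V [⋀^Fin q]→ₗ[ℝ] ℝ)
    (v : Fin (p + q) → V) :
    (p.factorial * q.factorial : ℝ) • wedge α β v =
      ∑ σ : Equiv.Perm (Fin p ⊕ Fin q), (Equiv.Perm.sign σ : ℤ) •
        (β (fun j => v (finSumFinEquiv (σ (.inr j)))) •
          α fun i => v (finSumFinEquiv (σ (.inl i)))) := by
  have h := MultilinearMap.domCoprod_alternization_eq α β
  have h' := congrArg (fun F => TensorProduct.rid ℝ W (F fun i => v (finSumFinEquiv i))) h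
  simp only [MultilinearMap.alternatization_apply, map_sum, Fintype.card_fin,
    AlternatingMap.smul_apply, map_nsmul, MultilinearMap.domDomCongr_apply,
    MultilinearMap.domCoprod_apply] at h'
  rw [← Nat.cast_mul, Nat.cast_smul_eq_nsmul]
  refine Eq.trans h'.symm (Finset.sum_congr rfl fun σ _ => ?_)
  rw [Units.smul_def, map_zsmul]
  simp

theorem contract_apply {l k : ℕ} (φ : V [⋀^Fin (l + k)]→ₗ[ℝ] ℝ) (u : Fin k → V) (w : Fin l → V) :
    contract φ u w = φ fun i => Fin.append u w (Fin.cast (Nat.add_comm l k) i) := by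
  induction k with
  | zero =>
    simp only [contract]
    congr 1
    ext i
    simp [Fin.append, Fin.addCases]
  | succ k ih =>
    rw [contract, ih]
    rw [AlternatingMap.curryLeft_apply_apply]
    congr 1
    ext i
    refine Fin.cases ?_ (fun i => ?_) i
    · simp [Fin.append, Fin.addCases]
      rfl
    · simp only [Fin.append, Fin.addCases, Fin.tail, Matrix.cons_val_succ]
      simp only [Fin.val_cast, Fin.val_succ, add_lt_add_iff_right]
      split_ifs with hi
      · rfl
      · simp only [eq_rec_constant]
        congr 1
        ext
        simp

theorem contract_comp_perm {l k : ℕ} (φ : V [⋀^Fin (l + k)]→ₗ[ℝ] ℝ) (u : Fin k → V)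
    (w : Fin l → V) (σ : Equiv.Perm (Fin k)) :
    contract φ (fun i => u (σ i)) w = (Equiv.Perm.sign σ : ℤ) • contract φ u w := by
  rw [contract_apply, contract_apply]
  let E : Fin k ⊕ Fin l ≃ Fin (l + k) := finSumFinEquiv.trans (finCongr (Nat.add_comm k l))
  let ρ : Equiv.Perm (Fin (l + k)) := E.permCongr (Equiv.Perm.sumCongr σ 1)
  have hρ : Equiv.Perm.sign ρ = Equiv.Perm.sign σ := by
    simp [ρ]
  rw [← hρ, ← Units.smul_def, ← AlternatingMap.map_perm]
  congr 1
  ext i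
  obtain ⟨j, rfl⟩ := E.surjective i
  rcases j with j | j <;> simp [ρ, E]

end Forms

variable {V : Type*} [NormedAddCommGroup V] [InnerProductSpace ℝ V] [FiniteDimensional ℝ V]
  {W : Type*} [AddCommGroup W] [Module ℝ W]

/-- Reindexing the basis tuple by σ makes the sign of σ in the wedge cancel the one from `vol`. All
(p+q)! permutations thus contribute equally, which removes the 1/(p+q)! of the star. -/
theorem hodgeStar_wedge_apply {p q l : ℕ} (vol : V [⋀^Fin (l + (p + q))]→ₗ[ℝ] ℝ)
    (α : V [⋀^Fin p]→ₗ[ℝ] W) (β : V [⋀^Fin q]→ₗ[ℝ] ℝ) (w : Fin l → V) :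
    (p.factorial * q.factorial : ℝ) • hodgeStar vol (wedge α β) w =
      ∑ f : Fin (p + q) → Fin (finrank ℝ V),
        (β (fun j => stdOrthonormalBasis ℝ V (f (Fin.natAdd p j))) *
          contract vol (fun j => stdOrthonormalBasis ℝ V (f j)) w) •
          α fun i => stdOrthonormalBasis ℝ V (f (Fin.castAdd q i)) := by
  set e := stdOrthonormalBasis ℝ V
  have key (σ : Equiv.Perm (Fin p ⊕ Fin q)) :
      ∑ f : Fin (p + q) → Fin (finrank ℝ V), contract vol (fun j => e (f j)) w •
        (Equiv.Perm.sign σ : ℤ) • (β (fun j => e (f (finSumFinEquiv (σ (.inr j))))) •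
          α fun i => e (f (finSumFinEquiv (σ (.inl i))))) =
      ∑ f : Fin (p + q) → Fin (finrank ℝ V),
        (β (fun j => e (f (Fin.natAdd p j))) * contract vol (fun j => e (f j)) w) •
          α fun i => e (f (Fin.castAdd q i)) := by
    let ρ : Equiv.Perm (Fin (p + q)) := finSumFinEquiv.permCongr σ
    have hρ : Equiv.Perm.sign ρ = Equiv.Perm.sign σ := by simp [ρ]
    refine Fintype.sum_equiv (Equiv.arrowCongr ρ.symm (Equiv.refl _)) _ _ fun f => ?_
    have h1 := contract_comp_perm vol (fun j => e (f j)) w ρ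
    have h2 : contract vol (fun j => e ((Equiv.arrowCongr ρ.symm (Equiv.refl _)) f j)) w
      = (Equiv.Perm.sign σ : ℤ) • contract vol (fun j => e (f j)) w := by
      rw [← hρ, ← h1]
      rfl
    rw [h2]
    have h3 (j : Fin q) : (Equiv.arrowCongr ρ.symm (Equiv.refl _)) f (Fin.natAdd p j)
        = f (finSumFinEquiv (σ (.inr j))) := by
      simp [ρ, Equiv.arrowCongr]
    have h4 (i : Fin p) : (Equiv.arrowCongr ρ.symm (Equiv.refl _)) f (Fin.castAdd q i)
        = f (finSumFinEquiv (σ (.inl i))) := by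
      simp [ρ, Equiv.arrowCongr]
    simp only [h3, h4]
    rw [← Int.cast_smul_eq_zsmul ℝ, ← Int.cast_smul_eq_zsmul ℝ, smul_smul, smul_smul]
    congr 1
    rw [smul_eq_mul]
    ring
  have hcard : Fintype.card (Equiv.Perm (Fin p ⊕ Fin q)) = (p + q).factorial := by
    rw [Fintype.card_perm]
    simp
  have hne : ((p + q).factorial : ℝ) ≠ 0 := by positivity
  have hstar : hodgeStar vol (wedge α β) w = ((p + q).factorial : ℝ)⁻¹ •
      ∑ f : Fin (p + q) → Fin (finrank ℝ V), contract vol (fun j => e (f j)) w •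
        wedge α β fun j => e (f j) := by
    rw [hodgeStar, AlternatingMap.smul_apply, alternatingMap_sum_apply]
    rfl
  rw [hstar, smul_comm, Finset.smul_sum]
  simp only [smul_comm (p.factorial * q.factorial : ℝ), factorial_smul_wedge_apply]
  simp only [Finset.smul_sum]
  rw [Finset.sum_comm]
  simp only [← Finset.smul_sum]
  simp only [key, Finset.sum_const, Finset.card_univ, hcard]
  rw [← Nat.cast_smul_eq_nsmul ℝ, smul_smul, inv_mul_cancel₀ hne, one_smul]

variable [Fact (finrank ℝ V = 8)] {S : Type*} [NormedAddCommGroup S] [InnerProductSpace ℝ S]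
  {o : Orientation ℝ V (Fin 8)} {c : V →L[ℝ] S →L[ℝ] S} {Ω : V [⋀^Fin 4]→ₗ[ℝ] ℝ} {η : S}

namespace IsCayleySpinor

/-- Summing out the four indices carried by `Ω` against the volume form replaces `Ω` by its dual,
which is `Ω` again. The factor ½ is 24/(2!·4!). -/
theorem hodgeStar_wedge (h : IsCayleySpinor o Ω c η) (α : V [⋀^Fin 2]→ₗ[ℝ] W)
    (k l : Fin (finrank ℝ V)) :
    hodgeStar (k := 2 + 4) (l := 2) o.volumeForm (wedge α Ω)
        ![stdOrthonormalBasis ℝ V k, stdOrthonormalBasis ℝ V l]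
      = (1 / 2 : ℝ) • ∑ i, ∑ j,
        Ω ![stdOrthonormalBasis ℝ V i, stdOrthonormalBasis ℝ V j, stdOrthonormalBasis ℝ V k,
          stdOrthonormalBasis ℝ V l] •
        α ![stdOrthonormalBasis ℝ V i, stdOrthonormalBasis ℝ V j] := by
  have H := hodgeStar_wedge_apply (p := 2) (q := 4) (l := 2) o.volumeForm α Ω
    ![stdOrthonormalBasis ℝ V k, stdOrthonormalBasis ℝ V l]
  set e := stdOrthonormalBasis ℝ V
  have hsplit (F : (Fin 6 → Fin (finrank ℝ V)) → W) :
      ∑ f, F f = ∑ i, ∑ j, ∑ g : Fin 4 → Fin (finrank ℝ V), F (Fin.cons i (Fin.cons j g)) := by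
    rw [← (Fin.consEquiv fun _ : Fin 6 => Fin (finrank ℝ V)).sum_comp, Fintype.sum_prod_type]
    refine Finset.sum_congr rfl fun i _ => ?_
    rw [← (Fin.consEquiv fun _ : Fin 5 => Fin (finrank ℝ V)).sum_comp, Fintype.sum_prod_type]
    rfl
  have hs : (48 : ℝ) • hodgeStar (k := 2 + 4) (l := 2) o.volumeForm (wedge α Ω) ![e k, e l]
      = (24 : ℝ) • ∑ i, ∑ j, Ω ![e i, e j, e k, e l] • α ![e i, e j] := by
    have h48 : (Nat.factorial 2 * Nat.factorial 4 : ℝ) = 48 := by norm_num [Nat.factorial]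
    rw [h48] at H
    rw [H]
    refine (hsplit _).trans ?_
    rw [Finset.smul_sum]
    refine Finset.sum_congr rfl fun i _ => ?_
    rw [Finset.smul_sum]
    refine Finset.sum_congr rfl fun j _ => ?_
    rw [smul_smul, ← h.sum_form_mul_volume e, Finset.sum_smul]
    refine Finset.sum_congr rfl fun g _ => ?_
    rw [contract_apply]
    congr 3
    · ext t; fin_cases t <;> rfl
    · ext t; fin_cases t <;> rfl
    · ext t; fin_cases t <;> rfl
  rw [← smul_right_inj (show (48 : ℝ) ≠ 0 by norm_num), hs, smul_smul]
  norm_num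

theorem mem_Lambda27_iff (h : IsCayleySpinor o Ω c η) (α : V [⋀^Fin 2]→ₗ[ℝ] W) :
    α ∈ Lambda27 o Ω W ↔ ∀ k l, (1 / 2 : ℝ) • ∑ i, ∑ j,
        Ω ![stdOrthonormalBasis ℝ V i, stdOrthonormalBasis ℝ V j, stdOrthonormalBasis ℝ V k,
          stdOrthonormalBasis ℝ V l] •
        α ![stdOrthonormalBasis ℝ V i, stdOrthonormalBasis ℝ V j]
      = (3 : ℝ) • α ![stdOrthonormalBasis ℝ V k, stdOrthonormalBasis ℝ V l] := by
  simp only [← h.hodgeStar_wedge]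
  constructor
  · intro hα k l
    exact congrArg (fun γ => γ ![stdOrthonormalBasis ℝ V k, stdOrthonormalBasis ℝ V l]) hα
  · intro hα
    refine Basis.ext_alternating (stdOrthonormalBasis ℝ V).toBasis fun v _ => ?_
    have e : (fun i => (stdOrthonormalBasis ℝ V).toBasis (v i)) =
        ![stdOrthonormalBasis ℝ V (v 0), stdOrthonormalBasis ℝ V (v 1)] := by
      ext i; fin_cases i <;> simp
    rw [e]
    exact hα _ _

end IsCayleySpinor

end HodgeWedge

/-! ### Positive spinors as Λ⁰ ⊕ Λ²_7, negative spinors as Λ¹ -/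

section SpinorsAsForms

section TwoForms

variable {V : Type*} [AddCommGroup V] [Module ℝ V] {W : Type*} [AddCommGroup W] [Module ℝ W]

theorem twoForm_self (α : V [⋀^Fin 2]→ₗ[ℝ] W) (u : V) : α ![u, u] = 0 :=
  α.map_eq_zero_of_eq _ (i := 0) (j := 1) rfl (by decide)

theorem twoForm_swap (α : V [⋀^Fin 2]→ₗ[ℝ] W) (u v : V) : α ![u, v] = -α ![v, u] := by
  rw [← AlternatingMap.map_swap α ![v, u] (i := 0) (j := 1) (by decide)]
  congr 1
  ext i
  fin_cases i <;> simp

theorem wedge_oneForm_apply (φ ψ : V →ₗ[ℝ] ℝ) (u v : V) :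
    wedge (oneForm φ) (oneForm ψ) ![u, v] = φ u * ψ v - φ v * ψ u := by
  have h := factorial_smul_wedge_apply (oneForm φ) (oneForm ψ) ![u, v]
  simp only [Nat.factorial, Nat.cast_one, mul_one, one_smul] at h
  rw [h]
  let E : Equiv.Perm (Fin 1 ⊕ Fin 1) ≃ Equiv.Perm (Fin 2) := finSumFinEquiv.permCongr
  have hE (σ : Equiv.Perm (Fin 2)) : Equiv.Perm.sign (E.symm σ) = Equiv.Perm.sign σ := by
    simp [E, Equiv.permCongr_symm]
  rw [← E.symm.sum_comp]
  simp only [hE]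
  have hv (σ : Equiv.Perm (Fin 2)) (x : Fin 1 ⊕ Fin 1) :
      finSumFinEquiv (E.symm σ x) = σ (finSumFinEquiv x) := by
    simp [E]
  simp only [hv, oneForm]
  rw [show (Finset.univ : Finset (Equiv.Perm (Fin 2))) = {1, Equiv.swap 0 1} by decide,
    Finset.sum_pair (by decide)]
  simp
  change ψ v * φ u + -(ψ u * φ v) = _
  ring

end TwoForms

variable {V : Type*} [NormedAddCommGroup V] [InnerProductSpace ℝ V]
  {S : Type*} [NormedAddCommGroup S] [InnerProductSpace ℝ S]
  {W : Type*} [AddCommGroup W] [Module ℝ W]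
  {o : Orientation ℝ V (Fin 8)} {c : V →L[ℝ] S →L[ℝ] S} {Ω : V [⋀^Fin 4]→ₗ[ℝ] ℝ} {η : S}

/-- The contraction `⟨s, ·⟩ ⊗ id` of a `W`-valued spinor with the spinor `s`. -/
def spinorContract (W : Type*) [AddCommGroup W] [Module ℝ W] (s : S) : S ⊗[ℝ] W →ₗ[ℝ] W :=
  (TensorProduct.lid ℝ W).toLinearMap ∘ₗ (innerₛₗ ℝ s).rTensor W

@[simp]
theorem spinorContract_tmul (s t : S) (w : W) :
    spinorContract W s (t ⊗ₜ[ℝ] w) = inner ℝ s t • w := by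
  simp [spinorContract]

section

variable [FiniteDimensional ℝ V]

/-- Clifford multiplication `α ↦ α · η = ∑_{i<j} (e_i · e_j · η) ⊗ α(e_i, e_j)` by `W`-valued
`2`-forms. -/
def cliffordTwo (c : V →L[ℝ] S →L[ℝ] S) (η : S) (W : Type*) [AddCommGroup W] [Module ℝ W] :
    (V [⋀^Fin 2]→ₗ[ℝ] W) →ₗ[ℝ] S ⊗[ℝ] W where
  toFun α := (1 / 2 : ℝ) • ∑ i, ∑ j,
    c (stdOrthonormalBasis ℝ V i) (c (stdOrthonormalBasis ℝ V j) η) ⊗ₜ[ℝ]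
      α ![stdOrthonormalBasis ℝ V i, stdOrthonormalBasis ℝ V j]
  map_add' α β := by
    simp only [AlternatingMap.add_apply, TensorProduct.tmul_add, Finset.sum_add_distrib, smul_add]
  map_smul' r α := by
    simp only [AlternatingMap.smul_apply, TensorProduct.tmul_smul, ← Finset.smul_sum,
      RingHom.id_apply]
    rw [smul_comm]

/-- Clifford multiplication `β ↦ β · η = ∑_{i<j} β(e_i, e_j) e_i · e_j · η` by real `2`-forms. -/
def cliffordTwoReal (c : V →L[ℝ] S →L[ℝ] S) (η : S) : (V [⋀^Fin 2]→ₗ[ℝ] ℝ) →ₗ[ℝ] S :=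
  (TensorProduct.rid ℝ S).toLinearMap ∘ₗ cliffordTwo c η ℝ

theorem cliffordTwoReal_apply (c : V →L[ℝ] S →L[ℝ] S) (η : S) (β : V [⋀^Fin 2]→ₗ[ℝ] ℝ) :
    cliffordTwoReal c η β = (1 / 2 : ℝ) • ∑ i, ∑ j,
      β ![stdOrthonormalBasis ℝ V i, stdOrthonormalBasis ℝ V j] •
        c (stdOrthonormalBasis ℝ V i) (c (stdOrthonormalBasis ℝ V j) η) := by
  simp [cliffordTwoReal, cliffordTwo]

theorem cliffordTwo_formTensor (β : V [⋀^Fin 2]→ₗ[ℝ] ℝ) (w : W) :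
    cliffordTwo c η W (formTensor β w) = cliffordTwoReal c η β ⊗ₜ[ℝ] w := by
  rw [cliffordTwoReal_apply, ← TensorProduct.smul_tmul', TensorProduct.sum_tmul]
  simp only [TensorProduct.sum_tmul, ← TensorProduct.smul_tmul', ← TensorProduct.tmul_smul]
  rfl

/-- `α = ∑_{i<j} (e^i ∧ e^j) ⊗ α(e_i, e_j)`. -/
theorem twoForm_eq_sum (α : V [⋀^Fin 2]→ₗ[ℝ] W) :
    α = (1 / 2 : ℝ) • ∑ i, ∑ j,
      formTensor (wedge (oneForm (innerₛₗ ℝ (stdOrthonormalBasis ℝ V i)))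
        (oneForm (innerₛₗ ℝ (stdOrthonormalBasis ℝ V j))))
      (α ![stdOrthonormalBasis ℝ V i, stdOrthonormalBasis ℝ V j]) := by
  set b := stdOrthonormalBasis ℝ V
  refine Basis.ext_alternating b.toBasis fun v _ => ?_
  have e : (fun i => b.toBasis (v i)) = ![b (v 0), b (v 1)] := by
    ext i; fin_cases i <;> simp
  rw [e, AlternatingMap.smul_apply, alternatingMap_sum_apply]
  simp only [alternatingMap_sum_apply, formTensor, LinearMap.compAlternatingMap_apply,
    LinearMap.toSpanSingleton_apply, wedge_oneForm_apply, innerₛₗ_apply_apply,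
    orthonormal_iff_ite.mp b.orthonormal]
  simp only [sub_smul, Finset.sum_sub_distrib, mul_ite, mul_one, mul_zero, ite_smul, one_smul,
    zero_smul, Finset.sum_ite_eq', Finset.mem_univ, if_true]
  rw [twoForm_swap α (b (v 1))]
  module

end

namespace IsCayleySpinor

variable {ι : Type*} [Fintype ι]

/-- For four distinct indices this is the relation defining `η`, after moving two factors across the
inner product. If an index repeats, the `Ω` term vanishes and anticommutation reduces the pairing to
orthonormality of the `e_i·η`. -/
theorem inner_two_two [DecidableEq ι] (h : IsCayleySpinor o Ω c η) (e : OrthonormalBasis ι ℝ V)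
    {i j k l : ι} (hij : i ≠ j) (hkl : k ≠ l) :
    inner ℝ (c (e k) (c (e l) η)) (c (e i) (c (e j) η))
      = (if i = k ∧ j = l then 1 else 0) - (if i = l ∧ j = k then 1 else 0)
        + Ω ![e i, e j, e k, e l] := by
  have hvec4 : ![e i, e j, e k, e l] = e ∘ ![i, j, k, l] := by
    ext t; fin_cases t <;> rfl
  have hanti {m n : ι} (hmn : m ≠ n) (s : S) : c (e m) (c (e n) s) = -c (e n) (c (e m) s) :=
    h.action.anticomm_of_orthogonal (e.orthonormal.2 hmn) s
  by_cases hinj : Function.Injective ![i, j, k, l]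
  · have horth : Orthonormal ℝ ![e i, e j, e k, e l] := by
      rw [hvec4]; exact e.orthonormal.comp _ hinj
    have hik : i ≠ k := fun hh => absurd (@hinj 0 2 hh) (by decide)
    have hil : i ≠ l := fun hh => absurd (@hinj 0 3 hh) (by decide)
    rw [h.form_eq _ horth, if_neg (fun hh => hik hh.1), if_neg (fun hh => hil hh.1)]
    simp only [Matrix.cons_val]
    rw [h.action.inner_two (e i) (e j), hanti hij.symm, inner_neg_right]
    simp
  · rw [hvec4, AlternatingMap.map_eq_zero_of_not_injective _ _ fun hh => hinj hh.of_comp, add_zero]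
    have hcases : i = k ∨ i = l ∨ j = k ∨ j = l := by
      by_contra hcon
      push Not at hcon
      refine hinj ?_
      rw [← List.nodup_ofFn]
      simp [List.ofFn_succ]
      tauto
    rcases hcases with rfl | rfl | rfl | rfl
    · have : i ≠ l := hkl
      simp [h.action.inner_apply_apply, h.inner_apply_basis, this, eq_comm]
    · rw [hanti hkl, inner_neg_left]
      simp [h.action.inner_apply_apply, h.inner_apply_basis, hkl.symm, eq_comm]
    · rw [hanti hij, inner_neg_right]
      simp [h.action.inner_apply_apply, h.inner_apply_basis, hkl, eq_comm]
    · rw [hanti hij, hanti hkl, inner_neg_right, inner_neg_left]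
      simp [h.action.inner_apply_apply, h.inner_apply_basis, hij, eq_comm]

/-- `⟨e_k · e_l · η, α · η⟩ = α_{kl} + ½ ∑ Ω_{ijkl} α_{ij}`. -/
theorem sum_inner_two_two (h : IsCayleySpinor o Ω c η) (e : OrthonormalBasis ι ℝ V)
    (α : V [⋀^Fin 2]→ₗ[ℝ] W) {k l : ι} (hkl : k ≠ l) :
    (1 / 2 : ℝ) • ∑ i, ∑ j,
        inner ℝ (c (e k) (c (e l) η)) (c (e i) (c (e j) η)) • α ![e i, e j]
      = α ![e k, e l] + (1 / 2 : ℝ) • ∑ i, ∑ j, Ω ![e i, e j, e k, e l] • α ![e i, e j] := by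
  classical
  have hterm (i j : ι) : inner ℝ (c (e k) (c (e l) η)) (c (e i) (c (e j) η)) • α ![e i, e j]
      = (if i = k ∧ j = l then α ![e k, e l] else 0) + (if i = l ∧ j = k then α ![e k, e l] else 0)
        + Ω ![e i, e j, e k, e l] • α ![e i, e j] := by
    by_cases hij : i = j
    · subst hij
      rw [twoForm_self, if_neg (fun hh => hkl (hh.1.symm.trans hh.2)),
        if_neg (fun hh => hkl (hh.2.symm.trans hh.1))]
      simp
    · rw [h.inner_two_two e hij hkl, add_smul, sub_smul, sub_eq_add_neg]
      congr 2
      · split_ifs with hh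
        · rw [hh.1, hh.2, one_smul]
        · rw [zero_smul]
      · split_ifs with hh
        · rw [hh.1, hh.2, one_smul, ← twoForm_swap]
        · rw [zero_smul, neg_zero]
  have h1 (m n : ι) : ∑ i, ∑ j, (if i = m ∧ j = n then α ![e k, e l] else 0) = α ![e k, e l] := by
    simp [ite_and]
  simp only [hterm, Finset.sum_add_distrib, h1]
  module

theorem two_mem_chiral (h : IsCayleySpinor o Ω c η) (u v : V) : c u (c v η) ∈ chiral o c 1 :=
  h.action.apply_mem_chiral_one (h.action.apply_mem_chiral_neg_one h.positive v) u

/-- The `2`-form `(u, v) ↦ ⟨u · v · η, s⟩` of a spinor `s` orthogonal to `η`. -/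
def twoFormOfSpinor (h : IsCayleySpinor o Ω c η) (s : S) (hs : inner ℝ η s = (0 : ℝ)) :
    V [⋀^Fin 2]→ₗ[ℝ] ℝ :=
  twoFormOfBilin (LinearMap.mk₂ ℝ (fun u v => inner ℝ (c u (c v η)) s)
    (by simp [inner_add_left]) (by simp [inner_smul_left]) (by simp [inner_add_left])
    (by simp [inner_smul_left])) fun v => by
      simp [h.action.sq, inner_smul_left, hs]

theorem twoFormOfSpinor_apply (h : IsCayleySpinor o Ω c η) {s : S} (hs : inner ℝ η s = (0 : ℝ))
    (u v : V) : h.twoFormOfSpinor s hs ![u, v] = inner ℝ (c u (c v η)) s :=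
  rfl

variable [FiniteDimensional ℝ V]

theorem cliffordTwoReal_mem_chiral (h : IsCayleySpinor o Ω c η) (β : V [⋀^Fin 2]→ₗ[ℝ] ℝ) :
    cliffordTwoReal c η β ∈ chiral o c 1 := by
  rw [cliffordTwoReal_apply]
  exact Submodule.smul_mem _ _ (Submodule.sum_mem _ fun i _ => Submodule.sum_mem _ fun j _ =>
    Submodule.smul_mem _ _ (h.two_mem_chiral _ _))

theorem inner_cliffordTwoReal (h : IsCayleySpinor o Ω c η) (β : V [⋀^Fin 2]→ₗ[ℝ] ℝ) :
    inner ℝ η (cliffordTwoReal c η β) = (0 : ℝ) := by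
  rw [cliffordTwoReal_apply, inner_smul_right, inner_sum]
  refine mul_eq_zero_of_right _ (Finset.sum_eq_zero fun i _ => ?_)
  rw [inner_sum]
  refine Finset.sum_eq_zero fun j _ => ?_
  rw [inner_smul_right]
  by_cases hij : i = j
  · rw [hij, twoForm_self, zero_mul]
  · rw [h.action.inner_two_self ((stdOrthonormalBasis ℝ V).orthonormal.2 hij), mul_zero]

theorem spinorContract_cliffordTwo_self (h : IsCayleySpinor o Ω c η) (α : V [⋀^Fin 2]→ₗ[ℝ] W) :
    spinorContract W η (cliffordTwo c η W α) = 0 := by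
  simp only [cliffordTwo, LinearMap.coe_mk, AddHom.coe_mk, map_smul, map_sum, spinorContract_tmul]
  refine smul_eq_zero_of_right _ (Finset.sum_eq_zero fun i _ => Finset.sum_eq_zero fun j _ => ?_)
  by_cases hij : i = j
  · rw [hij, twoForm_self, smul_zero]
  · rw [h.action.inner_two_self ((stdOrthonormalBasis ℝ V).orthonormal.2 hij), zero_smul]

variable [Fact (finrank ℝ V = 8)]

/-- The constant is 1 + 3, with 3 the eigenvalue defining Λ²_7. Hence α·η determines α. -/
theorem spinorContract_cliffordTwo (h : IsCayleySpinor o Ω c η) {α : V [⋀^Fin 2]→ₗ[ℝ] W}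
    (hα : α ∈ Lambda27 o Ω W) {k l : Fin (finrank ℝ V)} (hkl : k ≠ l) :
    spinorContract W
        (c (stdOrthonormalBasis ℝ V k) (c (stdOrthonormalBasis ℝ V l) η)) (cliffordTwo c η W α)
      = (4 : ℝ) • α ![stdOrthonormalBasis ℝ V k, stdOrthonormalBasis ℝ V l] := by
  have h1 := h.sum_inner_two_two (stdOrthonormalBasis ℝ V) α hkl
  rw [(h.mem_Lambda27_iff α).mp hα k l] at h1
  simp only [cliffordTwo, LinearMap.coe_mk, AddHom.coe_mk, map_smul, map_sum, spinorContract_tmul]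
  rw [h1]
  module

/-- The 64 spinors e_i·e_j·η form eight orthonormal bases of S⁺, one for each i, so the double sum
is 8s; the ½ of the sum over i < j leaves 4s. -/
theorem cliffordTwoReal_twoFormOfSpinor (h : IsCayleySpinor o Ω c η) {s : S}
    (hs : inner ℝ η s = (0 : ℝ)) (hs' : s ∈ chiral o c 1) :
    cliffordTwoReal c η (h.twoFormOfSpinor s hs) = (4 : ℝ) • s := by
  rw [cliffordTwoReal_apply]
  simp only [twoFormOfSpinor_apply]
  rw [h.sum_sum_inner_smul _ hs', smul_smul]
  norm_num

/-- Pair β·η = 4s with e_k·e_l·η, where β is the form of `s`: one side is 4β_{kl}, the other β_{kl}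
+ ⋆(β∧Ω)_{kl}, so the eigenvalue is 3. -/
theorem twoFormOfSpinor_mem (h : IsCayleySpinor o Ω c η) {s : S}
    (hs : inner ℝ η s = (0 : ℝ)) (hs' : s ∈ chiral o c 1) :
    h.twoFormOfSpinor s hs ∈ Lambda27 o Ω ℝ := by
  rw [h.mem_Lambda27_iff]
  intro k l
  by_cases hkl : k = l
  · subst hkl
    have h0 (i j : Fin (finrank ℝ V)) : Ω ![stdOrthonormalBasis ℝ V i, stdOrthonormalBasis ℝ V j,
        stdOrthonormalBasis ℝ V k, stdOrthonormalBasis ℝ V k] = 0 :=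
      Ω.map_eq_zero_of_eq _ (i := 2) (j := 3) rfl (by decide)
    simp [h0, twoForm_self]
  · have h1 := h.sum_inner_two_two (stdOrthonormalBasis ℝ V) (h.twoFormOfSpinor s hs) hkl
    have h2 := congrArg (fun t => inner ℝ (c (stdOrthonormalBasis ℝ V k)
      (c (stdOrthonormalBasis ℝ V l) η)) t) (h.cliffordTwoReal_twoFormOfSpinor hs hs')
    simp only [cliffordTwoReal_apply, inner_smul_right, inner_sum] at h2
    simp only [smul_eq_mul, mul_comm (inner ℝ _ _ : ℝ) (h.twoFormOfSpinor s hs _)] at h1 ⊢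
    rw [h2, ← h.twoFormOfSpinor_apply hs] at h1
    linarith

theorem formTensor_mem_Lambda27 (h : IsCayleySpinor o Ω c η) {β : V [⋀^Fin 2]→ₗ[ℝ] ℝ}
    (hβ : β ∈ Lambda27 o Ω ℝ) (w : W) : formTensor β w ∈ Lambda27 o Ω W := by
  rw [h.mem_Lambda27_iff] at hβ ⊢
  intro k l
  have := congrArg (fun r : ℝ => r • w) (hβ k l)
  simpa [formTensor, Finset.sum_smul, smul_smul, ← Finset.smul_sum, ← smul_smul] using this

/-- If δ is orthogonal to Λ²_7 and s = δ·η, then |s|² is the inner product of δ with the 2-form of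
`s`. That form lies in Λ²_7, so s = 0; apply this to δ = β − π₇β. -/
theorem cliffordTwoReal_pi7Real (h : IsCayleySpinor o Ω c η) (β : V [⋀^Fin 2]→ₗ[ℝ] ℝ) :
    pi7Real o Ω β ∈ Lambda27 o Ω ℝ ∧
      cliffordTwoReal c η (pi7Real o Ω β) = cliffordTwoReal c η β := by
  let _ : NormedAddCommGroup (V [⋀^Fin 2]→ₗ[ℝ] ℝ) := twoFormCore.toNormedAddCommGroup
  let _ : InnerProductSpace ℝ (V [⋀^Fin 2]→ₗ[ℝ] ℝ) := .ofCore twoFormCore.toCore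
  have hpi : pi7Real o Ω β = (Lambda27 o Ω ℝ).starProjection β := rfl
  refine ⟨by rw [hpi]; exact Submodule.starProjection_apply_mem _ _, ?_⟩
  have horth : ∀ γ ∈ Lambda27 o Ω ℝ, inner ℝ γ (β - pi7Real o Ω β) = (0 : ℝ) :=
    (Submodule.mem_orthogonal _ _).mp (by
      rw [hpi]; exact Submodule.sub_starProjection_mem_orthogonal β)
  set δ := β - pi7Real o Ω β with hδ
  set s := cliffordTwoReal c η δ with hs
  have h0 := horth _ (h.twoFormOfSpinor_mem (h.inner_cliffordTwoReal δ)
    (h.cliffordTwoReal_mem_chiral δ))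
  have hin (γ : V [⋀^Fin 2]→ₗ[ℝ] ℝ) : inner ℝ γ δ = (1 / 2 : ℝ) * ∑ i, ∑ j,
      γ ![stdOrthonormalBasis ℝ V i, stdOrthonormalBasis ℝ V j] *
      δ ![stdOrthonormalBasis ℝ V i, stdOrthonormalBasis ℝ V j] := rfl
  rw [hin] at h0
  simp only [twoFormOfSpinor_apply] at h0
  have h1 : inner ℝ s s = (0 : ℝ) := by
    have hinner (t : S) : inner ℝ s t = (1 / 2 : ℝ) * ∑ i, ∑ j,
        inner ℝ (c (stdOrthonormalBasis ℝ V i) (c (stdOrthonormalBasis ℝ V j) η)) t *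
          δ ![stdOrthonormalBasis ℝ V i, stdOrthonormalBasis ℝ V j] := by
      rw [hs, cliffordTwoReal_apply, inner_smul_left, sum_inner]
      simp only [sum_inner, inner_smul_left]
      simp [mul_comm]
    rw [hinner, ← h0]
  have h2 : s = 0 := inner_self_eq_zero.mp h1
  rw [hs, hδ, map_sub, sub_eq_zero] at h2
  exact h2.symm

theorem cliffordTwo_pi7 (h : IsCayleySpinor o Ω c η) (α : V [⋀^Fin 2]→ₗ[ℝ] W) :
    cliffordTwo c η W (pi7 o Ω α) = cliffordTwo c η W α := by
  conv_rhs => rw [twoForm_eq_sum α]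
  simp only [pi7, map_smul, map_sum, cliffordTwo_formTensor, (h.cliffordTwoReal_pi7Real _).2]

theorem pi7_mem (h : IsCayleySpinor o Ω c η) (α : V [⋀^Fin 2]→ₗ[ℝ] W) :
    pi7 o Ω α ∈ Lambda27 o Ω W :=
  Submodule.smul_mem _ _ (Submodule.sum_mem _ fun _ _ => Submodule.sum_mem _ fun _ _ =>
    h.formTensor_mem_Lambda27 (h.cliffordTwoReal_pi7Real _).1 _)

/-- `τ ↦ τ · η` is an isomorphism `Λ¹ ⊗ W ≅ S⁻ ⊗ W`. -/
theorem oneForm_isomorphism (h : IsCayleySpinor o Ω c η) [TopologicalSpace W]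
    [IsTopologicalAddGroup W] [ContinuousSMul ℝ W] {L : (V →L[ℝ] W) →ₗ[ℝ] S ⊗[ℝ] W}
    (hL : ∀ τ, L τ = ∑ i, c (stdOrthonormalBasis ℝ V i) η ⊗ₜ[ℝ] τ (stdOrthonormalBasis ℝ V i)) :
    Function.Injective L ∧
      LinearMap.range L = LinearMap.range ((chiral o c (-1)).subtype.rTensor W) := by
  set e := stdOrthonormalBasis ℝ V
  constructor
  · rw [injective_iff_map_eq_zero]
    intro τ hτ
    ext v
    have h0 (k : Fin (finrank ℝ V)) : τ (e k) = 0 := by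
      -- Contracting with `e_k·η` reads off the component τ(e_k) by orthonormality.
      have := congrArg (spinorContract W (c (e k) η)) hτ
      simpa [hL, h.inner_apply_basis] using this
    rw [← e.sum_repr v]
    simp [h0]
  · apply le_antisymm
    · rintro _ ⟨τ, rfl⟩
      rw [hL]
      exact Submodule.sum_mem _ fun i _ => ⟨(⟨c (e i) η,
        h.action.apply_mem_chiral_neg_one h.positive (e i)⟩ : chiral o c (-1)) ⊗ₜ τ (e i), rfl⟩
    · rintro _ ⟨t, rfl⟩
      induction t with
      | zero => simp
      | add a b ha hb => rw [map_add]; exact Submodule.add_mem _ ha hb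
      | tmul s w =>
        -- The preimage of s ⊗ w is v ↦ ⟨s, v·η⟩ w, from expanding `s` in the basis `e_i·η`.
        refine ⟨(((innerSL ℝ (s : S)).comp (c.flip η)).smulRight w), ?_⟩
        rw [hL, LinearMap.rTensor_tmul, Submodule.subtype_apply]
        nth_rewrite 2 [← h.sum_inner_smul_of_mem_neg e s.2]
        rw [TensorProduct.sum_tmul]
        refine Finset.sum_congr rfl fun i _ => ?_
        rw [← TensorProduct.smul_tmul', ← TensorProduct.tmul_smul]
        simp [real_inner_comm]

/-- `(f, α) ↦ f η + α · η` is an isomorphism `(Λ⁰ ⊕ Λ²_7) ⊗ W ≅ S⁺ ⊗ W`. -/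
theorem evenForm_isomorphism (h : IsCayleySpinor o Ω c η)
    {L : (W × (V [⋀^Fin 2]→ₗ[ℝ] W)) →ₗ[ℝ] S ⊗[ℝ] W}
    (hL : ∀ p, L p = η ⊗ₜ[ℝ] p.1 + cliffordTwo c η W p.2) :
    Set.InjOn L (Submodule.prod (⊤ : Submodule ℝ W) (Lambda27 o Ω W) : Submodule ℝ _) ∧
      (Submodule.prod ⊤ (Lambda27 o Ω W)).map L
        = LinearMap.range ((chiral o c 1).subtype.rTensor W) := by
  have hηη : inner ℝ η η = (1 : ℝ) := by rw [real_inner_self_eq_norm_sq, h.norm_eq]; norm_num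
  constructor
  · rintro p hp q hq hpq
    rw [← sub_eq_zero, ← map_sub] at hpq
    have hmem : (p - q).2 ∈ Lambda27 o Ω W := (Submodule.sub_mem _ hp hq).2
    rw [← sub_eq_zero]
    generalize p - q = r at hpq hmem ⊢
    rw [hL] at hpq
    have h1 : r.1 = 0 := by
      have := congrArg (spinorContract W η) hpq
      simpa [h.spinorContract_cliffordTwo_self, h.norm_eq] using this
    rw [h1, TensorProduct.tmul_zero, zero_add] at hpq
    refine Prod.ext h1 (Basis.ext_alternating (stdOrthonormalBasis ℝ V).toBasis fun v hv => ?_)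
    have e : (fun i => (stdOrthonormalBasis ℝ V).toBasis (v i)) =
        ![stdOrthonormalBasis ℝ V (v 0), stdOrthonormalBasis ℝ V (v 1)] := by
      ext i; fin_cases i <;> simp
    have h4 := h.spinorContract_cliffordTwo hmem (k := v 0) (l := v 1)
      fun hh => absurd (hv hh) (by decide)
    rw [hpq, map_zero] at h4
    rw [e]
    exact (smul_eq_zero.mp h4.symm).resolve_left (by norm_num)
  · apply le_antisymm
    · rintro _ ⟨p, -, rfl⟩
      rw [hL]
      refine Submodule.add_mem _ ⟨(⟨η, h.positive⟩ : chiral o c 1) ⊗ₜ p.1, rfl⟩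
        (Submodule.smul_mem _ _ (Submodule.sum_mem _ fun i _ => Submodule.sum_mem _ fun j _ =>
          ⟨(⟨_, h.two_mem_chiral _ _⟩ : chiral o c 1) ⊗ₜ _, rfl⟩))
    · rintro _ ⟨t, rfl⟩
      induction t with
      | zero => simp
      | add a b ha hb => rw [map_add]; exact Submodule.add_mem _ ha hb
      | tmul s w =>
        -- The component along `η` comes from Λ⁰; the remainder comes from its own 2-form, with ¼
        -- undoing the factor 4.
        set s' : S := s - (inner ℝ η (s : S) : ℝ) • η with hs'
        have hs0 : inner ℝ η s' = (0 : ℝ) := by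
          rw [hs', inner_sub_right, inner_smul_right, hηη]
          ring
        have hmem : s' ∈ chiral o c 1 :=
          Submodule.sub_mem _ s.2 (Submodule.smul_mem _ _ h.positive)
        refine ⟨((inner ℝ η (s : S) : ℝ) • w,
          formTensor ((1 / 4 : ℝ) • h.twoFormOfSpinor s' hs0) w), ⟨trivial,
            h.formTensor_mem_Lambda27
              (Submodule.smul_mem _ _ (h.twoFormOfSpinor_mem hs0 hmem)) w⟩, ?_⟩
        rw [hL, cliffordTwo_formTensor, map_smul, h.cliffordTwoReal_twoFormOfSpinor hs0 hmem,
          smul_smul, LinearMap.rTensor_tmul, Submodule.subtype_apply, TensorProduct.tmul_smul,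
          TensorProduct.smul_tmul', ← TensorProduct.add_tmul, hs']
        congr 1
        module

end IsCayleySpinor

end SpinorsAsForms

/-! ### Product rule for the tensor product connection -/

section TensorDerivative

variable {M : Type*} [TopologicalSpace M] [ChartedSpace E8 M]

section Leibniz

variable {F : Type*} [NormedAddCommGroup F] [NormedSpace ℝ F]
  {V : M → Type*} [TopologicalSpace (TotalSpace F V)]
  [∀ x, TopologicalSpace (V x)] [FiberBundle F V]

variable (F) in
/-- Differentiability of a section at a point. -/
abbrev SectionDiffAt (σ : Π y : M, V y) (x : M) : Prop :=
  MDifferentiableAt (𝓡 8) ((𝓡 8).prod 𝓘(ℝ, F)) (fun y => TotalSpace.mk' F y (σ y)) x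

theorem SectionDiffAt.congr {σ σ' : Π y : M, V y} {x : M}
    (hσ : SectionDiffAt F σ x) (h : ∀ᶠ y in nhds x, σ' y = σ y) : SectionDiffAt F σ' x :=
  hσ.congr_of_eventuallyEq (h.mono fun y hy => by simp [hy])

variable [∀ x, AddCommGroup (V x)] [∀ x, Module ℝ (V x)] [∀ x, IsTopologicalAddGroup (V x)]
  [∀ x, ContinuousSMul ℝ (V x)] [VectorBundle ℝ F V]

theorem covariantDerivative_sum {κ : Type*} (D : CovariantDerivative (𝓡 8) F V) {x : M}
    (s : Finset κ) {σ : κ → Π y : M, V y} (hσ : ∀ k, SectionDiffAt F (σ k) x) :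
    D (fun y => ∑ k ∈ s, σ k y) x = ∑ k ∈ s, D (σ k) x := by
  classical
  induction s using Finset.induction_on with
  | empty =>
    simp only [Finset.sum_empty]
    exact D.isCovariantDerivativeOn.zero
  | insert a s ha ih =>
    simp only [Finset.sum_insert ha, ← ih]
    exact D.isCovariantDerivativeOn.add (hσ a) (.sum_section fun k _ => hσ k)

/-- The Leibniz rule for a section that is near `x` a linear combination of other sections. -/
theorem covariantDerivative_sum_smul {κ : Type*} [Fintype κ] (D : CovariantDerivative (𝓡 8) F V)
    {x : M} {f : κ → M → ℝ} {σ : κ → Π y : M, V y} {σ' : Π y : M, V y}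
    (hf : ∀ k, MDifferentiableAt (𝓡 8) 𝓘(ℝ, ℝ) (f k) x) (hσ : ∀ k, SectionDiffAt F (σ k) x)
    (h : ∀ᶠ y in nhds x, σ' y = ∑ k, f k y • σ k y) (v : TangentSpace (𝓡 8) x) :
    D σ' x v = ∑ k, (f k x • D (σ k) x v + mvfderiv (𝓡 8) (f k) x v • σ k x) := by
  have hfσ (k : κ) : SectionDiffAt F (f k • σ k) x := (hf k).smul_section (hσ k)
  have hsum : SectionDiffAt F (fun y => ∑ k, (f k • σ k) y) x := .sum_section fun k _ => hfσ k
  rw [D.isCovariantDerivativeOn.congr_of_eventuallyEq (hsum.congr h) hsum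
    Filter.univ_mem h, covariantDerivative_sum D _ hfσ, sum_apply]
  refine Finset.sum_congr rfl fun k _ => ?_
  rw [D.isCovariantDerivativeOn.leibniz (hσ k) (hf k)]
  rfl

end Leibniz

variable {FE : Type*} [NormedAddCommGroup FE] [NormedSpace ℝ FE]
  {E : M → Type*} [TopologicalSpace (TotalSpace FE E)]
  [∀ x, AddCommGroup (E x)] [∀ x, Module ℝ (E x)] [∀ x, TopologicalSpace (E x)]
  [∀ x, IsTopologicalAddGroup (E x)] [∀ x, ContinuousSMul ℝ (E x)]
  [FiberBundle FE E] [VectorBundle ℝ FE E]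
  {FS : Type*} [NormedAddCommGroup FS] [NormedSpace ℝ FS]
  {S : M → Type*} [TopologicalSpace (TotalSpace FS S)]
  [∀ x, NormedAddCommGroup (S x)] [∀ x, InnerProductSpace ℝ (S x)]
  [FiberBundle FS S] [VectorBundle ℝ FS S] [FiniteDimensional ℝ FS]
  [ContMDiffVectorBundle 1 FS S (𝓡 8)]

/-- The product rule for the tensor product connection. -/
theorem tensorDerivative_eq_sum {κ : Type*} [Fintype κ] (D : CovariantDerivative (𝓡 8) FS S)
    (A : CovariantDerivative (𝓡 8) FE E) {Ψ : Π y : M, S y ⊗[ℝ] E y} {x : M}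
    {σ : κ → Π y : M, S y} {ζ : κ → Π y : M, E y} (hσ : ∀ k, SectionDiffAt FS (σ k) x)
    (hζ : ∀ k, SectionDiffAt FE (ζ k) x) (h : ∀ᶠ y in nhds x, Ψ y = ∑ k, σ k y ⊗ₜ[ℝ] ζ k y)
    (v : TangentSpace (𝓡 8) x) :
    tensorDerivative D A Ψ x v = ∑ k, (D (σ k) x v ⊗ₜ[ℝ] ζ k x + σ k x ⊗ₜ[ℝ] A (ζ k) x v) := by
  set t := trivializationAt FS S x with ht
  set b := finBasis ℝ FS with hb
  let s (a : Fin (finrank ℝ FS)) (y : M) : S y := t.symm y (b a)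
  let φ (a : Fin (finrank ℝ FS)) (y : M) : S y →ₗ[ℝ] ℝ := b.coord a ∘ₗ t.linearMapAt ℝ y
  let ε (a : Fin (finrank ℝ FS)) (y : M) : E y :=
    TensorProduct.lid ℝ (E y) ((φ a y).rTensor (E y) (Ψ y))
  have hx : x ∈ t.baseSet := mem_baseSet_trivializationAt FS S x
  have hbase : ∀ᶠ y in nhds x, y ∈ t.baseSet := t.open_baseSet.mem_nhds hx
  have hs (a : Fin (finrank ℝ FS)) : SectionDiffAt FS (s a) x := by
    -- A vector constant in the trivialization is the canonical extension of its value at `x`, hence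
    -- differentiable there.
    have : s a = extend FS (s a x) := by
      ext y
      simp only [s, extend]
      rw [t.apply_mk_symm hx]
    rw [this]
    exact mdifferentiableAt_extend ..
  have hφ (a : Fin (finrank ℝ FS)) (k : κ) : MDifferentiableAt (𝓡 8) 𝓘(ℝ, ℝ) (fun y => φ a y (σ k y)) x := by
    have h1 := (t.mdifferentiableAt_section_iff (𝓡 8) (σ k) hx).mp (hσ k)
    have h2 : MDifferentiableAt (𝓡 8) 𝓘(ℝ, ℝ) (fun y => (LinearMap.toContinuousLinearMap (b.coord a))
        (t ⟨y, σ k y⟩).2) x :=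
      (LinearMap.toContinuousLinearMap (b.coord a)).mdifferentiableAt.comp x h1
    refine h2.congr_of_eventuallyEq (hbase.mono fun y hy => ?_)
    simp [φ, t.coe_linearMapAt_of_mem hy]
  have hσs (k : κ) : ∀ᶠ y in nhds x, σ k y = ∑ a, φ a y (σ k y) • s a y := by
    filter_upwards [hbase] with y hy
    have h1 : ∑ a, φ a y (σ k y) • s a y
        = t.symmₗ ℝ y (∑ a, b.coord a (t.linearMapAt ℝ y (σ k y)) • b a) := by
      simp only [φ, s, map_sum, map_smul, LinearMap.comp_apply]
      simp only [t.symmₗ_apply hy]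
    rw [h1]
    simp only [Basis.coord_apply, b.sum_repr]
    rw [t.symmₗ_linearMapAt hy]
  have hε (a : Fin (finrank ℝ FS)) : ∀ᶠ y in nhds x, ε a y = ∑ k, φ a y (σ k y) • ζ k y := by
    filter_upwards [h] with y hy
    simp [ε, hy]
  have hD (k : κ) := covariantDerivative_sum_smul D (fun a => hφ a k) hs (hσs k) v
  have hA (a : Fin (finrank ℝ FS)) := covariantDerivative_sum_smul A (fun k => hφ a k) hζ (hε a) v
  change ∑ a, (D (s a) x v ⊗ₜ[ℝ] ε a x + s a x ⊗ₜ[ℝ] A (ε a) x v) = _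
  -- Expand `σ k` in the local frame. The derivatives of the coefficients φ_a(σ_k) come from `D`
  -- here and from `A (ε a)` in the definition; they match because scalars pass through the tensor
  -- product.
  have hleft (k : κ) : D (σ k) x v ⊗ₜ[ℝ] ζ k x + σ k x ⊗ₜ[ℝ] A (ζ k) x v
      = ∑ a, (φ a x (σ k x) • (D (s a) x v ⊗ₜ[ℝ] ζ k x)
        + mvfderiv (𝓡 8) (fun y => φ a y (σ k y)) x v • (s a x ⊗ₜ[ℝ] ζ k x)
        + φ a x (σ k x) • (s a x ⊗ₜ[ℝ] A (ζ k) x v)) := by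
    rw [hD k]
    nth_rewrite 2 [(hσs k).self_of_nhds]
    simp only [TensorProduct.sum_tmul, TensorProduct.add_tmul, ← TensorProduct.smul_tmul',
      Finset.sum_add_distrib]
  simp only [hleft]
  rw [Finset.sum_comm]
  refine Finset.sum_congr rfl fun a _ => ?_
  rw [hA a, (hε a).self_of_nhds]
  simp only [TensorProduct.tmul_sum, TensorProduct.tmul_add, TensorProduct.tmul_smul,
      Finset.sum_add_distrib]
  abel

end TensorDerivative

/-! ### Dual frames -/

section DualFrame

/-- `∑ᵢ f(e_i) ⊗ g(e_i)` can be computed in any pair of dual bases. -/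
theorem sum_tmul_eq_of_biorthogonal {V : Type*} [NormedAddCommGroup V] [InnerProductSpace ℝ V]
    {S W : Type*} [AddCommGroup S] [Module ℝ S] [AddCommGroup W] [Module ℝ W]
    {ι : Type*} [Fintype ι] [DecidableEq ι] (e : OrthonormalBasis ι ℝ V)
    {κ : Type*} [Fintype κ] [DecidableEq κ] (hκ : Fintype.card κ = finrank ℝ V)
    {X Z : κ → V} (hZX : ∀ k l, inner ℝ (Z k) (X l) = if k = l then (1 : ℝ) else 0)
    (f : V →ₗ[ℝ] S) (g : V →ₗ[ℝ] W) :
    ∑ i, f (e i) ⊗ₜ[ℝ] g (e i) = ∑ k, f (X k) ⊗ₜ[ℝ] g (Z k) := by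
  -- Pairing with `Z` shows independence of `X`; by cardinality `X` is then a basis, with
  -- coefficients given by `Z`.
  have hli : LinearIndependent ℝ X := by
    rw [Fintype.linearIndependent_iff]
    intro r hr k
    have := congrArg (inner ℝ (Z k)) hr
    simpa [inner_sum, inner_smul_right, hZX] using this
  have : FiniteDimensional ℝ V := e.toBasis.finiteDimensional_of_finite
  have hexp (v : V) : v = ∑ k, (inner ℝ (Z k) v : ℝ) • X k := by
    have hmem : v ∈ Submodule.span ℝ (Set.range X) := by
      rw [hli.span_eq_top_of_card_eq_finrank' hκ]
      trivial
    obtain ⟨r, rfl⟩ := (Submodule.mem_span_range_iff_exists_fun ℝ).mp hmem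
    simp [inner_sum, inner_smul_right, hZX]
  have hf (i : ι) : f (e i) = ∑ k, (inner ℝ (Z k) (e i) : ℝ) • f (X k) := by
    conv_lhs => rw [hexp (e i)]
    simp
  have hg (k : κ) : g (Z k) = ∑ i, (inner ℝ (Z k) (e i) : ℝ) • g (e i) := by
    conv_lhs => rw [← e.sum_repr' (Z k)]
    simp [real_inner_comm]
  simp only [hf, hg, TensorProduct.sum_tmul, TensorProduct.tmul_sum]
  rw [Finset.sum_comm]
  simp only [TensorProduct.smul_tmul]

variable {M : Type*} [TopologicalSpace M] [ChartedSpace E8 M]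

theorem mdifferentiableAt_matrix_det {n : Type} [Fintype n] [DecidableEq n]
    {G : M → Matrix n n ℝ} {x : M}
    (hG : ∀ i j, MDifferentiableAt (𝓡 8) 𝓘(ℝ, ℝ) (fun y => G y i j) x) :
    MDifferentiableAt (𝓡 8) 𝓘(ℝ, ℝ) (fun y => (G y).det) x := by
  have h (f : Equiv.Perm n) :
      MDifferentiableAt (𝓡 8) 𝓘(ℝ, ℝ) (fun y => ∏ i, G y (f i) i) x := by
    have := MDifferentiableAt.prod (t := Finset.univ) (I := 𝓡 8) (z := x)
      (f := fun i y => G y (f i) i) fun i _ => hG (f i) i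
    exact this.congr_of_eventuallyEq (Filter.Eventually.of_forall fun y => by simp)
  have h2 : MDifferentiableAt (𝓡 8) 𝓘(ℝ, ℝ)
      (∑ f : Equiv.Perm n, fun y => ((f.sign : ℤ) : ℝ) * ∏ i, G y (f i) i) x :=
    MDifferentiableAt.sum fun f _ => mdifferentiableAt_const.mul (h f)
  exact h2.congr_of_eventuallyEq
    (Filter.Eventually.of_forall fun y => by simp [Matrix.det_apply'])

theorem mdifferentiableAt_matrix_inv {n : Type} [Fintype n] [DecidableEq n]
    {G : M → Matrix n n ℝ} {x : M}
    (hG : ∀ i j, MDifferentiableAt (𝓡 8) 𝓘(ℝ, ℝ) (fun y => G y i j) x) (hx : (G x).det ≠ 0)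
    (i j : n) : MDifferentiableAt (𝓡 8) 𝓘(ℝ, ℝ) (fun y => (G y)⁻¹ i j) x := by
  have hadj : MDifferentiableAt (𝓡 8) 𝓘(ℝ, ℝ) (fun y => (G y).adjugate i j) x := by
    simp only [Matrix.adjugate_apply]
    refine mdifferentiableAt_matrix_det fun k l => ?_
    by_cases hk : k = j
    -- In the adjugate, row `j` is replaced by a constant vector.
    · subst hk
      simpa using mdifferentiableAt_const
    · simpa [Matrix.updateRow_ne hk] using hG k l
  have hdet : MDifferentiableAt (𝓡 8) 𝓘(ℝ, ℝ) (fun y => ((G y).det)⁻¹) x :=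
    (differentiableAt_inv hx).comp_mdifferentiableAt (f := fun y => (G y).det)
      (mdifferentiableAt_matrix_det hG)
  refine (hdet.mul hadj).congr_of_eventuallyEq (Filter.Eventually.of_forall fun y => ?_)
  simp [Matrix.inv_def]

variable [IsManifold (𝓡 8) ∞ M] [RiemannianBundle (fun x : M => TangentSpace (𝓡 8) x)]
  [IsContMDiffRiemannianBundle (𝓡 8) ∞ E8 (fun x : M => TangentSpace (𝓡 8) x)]

/-- A differentiable frame which is orthonormal at `x` has a differentiable dual frame near `x`. -/
theorem exists_dual_frame {n : Type} [Fintype n] [DecidableEq n] {x : M}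
    {X : n → Π y : M, TangentSpace (𝓡 8) y} (hX : ∀ k, SectionDiffAt E8 (X k) x)
    (horth : Orthonormal ℝ fun k => X k x) :
    ∃ Z : n → Π y : M, TangentSpace (𝓡 8) y, (∀ k, SectionDiffAt E8 (Z k) x) ∧
      (∀ k, Z k x = X k x) ∧
      ∀ᶠ y in nhds x, ∀ k l, inner ℝ (Z k y) (X l y) = if k = l then (1 : ℝ) else 0 := by
  let G (y : M) : Matrix n n ℝ := Matrix.of fun j k => inner ℝ (X j y) (X k y)
  have hGx : G x = 1 := by
    ext j k
    simp only [G, Matrix.of_apply, Matrix.one_apply]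
    exact orthonormal_iff_ite.mp horth j k
  have hG (j k : n) : MDifferentiableAt (𝓡 8) 𝓘(ℝ, ℝ) (fun y => G y j k) x :=
    MDifferentiableAt.inner_bundle (hX j) (hX k)
  have hdet : (G x).det ≠ 0 := by simp [hGx]
  have hinv := mdifferentiableAt_matrix_inv hG hdet
  have hunit := (mdifferentiableAt_matrix_det hG).continuousAt.eventually_ne hdet
  -- Apply the inverse Gram matrix, which is the identity at `x` and stays invertible nearby. This
  -- replaces Gram–Schmidt, so no orthonormal frame around `x` is needed.
  refine ⟨fun k y => ∑ j, (G y)⁻¹ k j • X j y, fun k => ?_, fun k => ?_, ?_⟩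
  · exact .sum_section fun j _ => (hinv k j).smul_section (hX j)
  · simp [hGx, Matrix.one_apply]
  · filter_upwards [hunit] with y hy k l
    have h1 : ((G y)⁻¹ * G y) k l = (1 : Matrix n n ℝ) k l := by
      rw [Matrix.nonsing_inv_mul _ (isUnit_iff_ne_zero.mpr hy)]
    rw [Matrix.mul_apply, Matrix.one_apply] at h1
    rw [← h1, sum_inner]
    simp [G, inner_smul_left]

end DualFrame

/-! ### Covariant derivatives of one-forms, torsion and the codifferential -/

section CovariantDerivativeOfOneForm

theorem sum_two_mul_inner_smul {V : Type*} [NormedAddCommGroup V] [InnerProductSpace ℝ V]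
    {ι : Type*} [Fintype ι] (e : OrthonormalBasis ι ℝ V) (v : V) :
    (1 / 2 : ℝ) • ∑ i, (2 * inner ℝ (e i) v : ℝ) • e i = v := by
  simp only [mul_smul, ← Finset.smul_sum, e.sum_repr']
  rw [smul_smul]
  norm_num

section Contraction

variable {M : Type*} [TopologicalSpace M] [ChartedSpace E8 M]
  [RiemannianBundle (fun x : M => TangentSpace (𝓡 8) x)]
  {E : M → Type*} [∀ x, AddCommGroup (E x)] [∀ x, Module ℝ (E x)] [∀ x, TopologicalSpace (E x)]

/-- A 3-form is invariant under cyclic rotation, so contracting in the first slot agrees with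
contracting in the last, where the torsion vector `t` sits. -/
theorem contractOneForm_apply {x : M} (T : TangentSpace (𝓡 8) x [⋀^Fin 3]→ₗ[ℝ] ℝ)
    (τ : TangentSpace (𝓡 8) x →L[ℝ] E x) {u v t : TangentSpace (𝓡 8) x}
    (h : ∀ w, T ![u, v, w] = inner ℝ t w) : contractOneForm T τ ![u, v] = τ t := by
  have hrot (w : TangentSpace (𝓡 8) x) : T ![w, u, v] = T ![u, v, w] := by
    have := T.map_perm ![u, v, w] (finRotate 3).symm
    have h2 : ![u, v, w] ∘ (finRotate 3).symm = ![w, u, v] := by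
      ext i
      fin_cases i <;> rfl
    rw [h2] at this
    simpa using this
  have hi (w : TangentSpace (𝓡 8) x) : T.curryLeft w ![u, v] = inner ℝ w t := by
    rw [real_inner_comm, ← h, ← hrot]
    rfl
  conv_rhs => rw [← (stdOrthonormalBasis ℝ (TangentSpace (𝓡 8) x)).sum_repr' t]
  rw [contractOneForm, alternatingMap_sum_apply]
  simp [formTensor, hi]

end Contraction

variable {M : Type*} [TopologicalSpace M] [ChartedSpace E8 M] [IsManifold (𝓡 8) ∞ M]
  {FE : Type*} [NormedAddCommGroup FE] [NormedSpace ℝ FE]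
  {E : M → Type*} [TopologicalSpace (TotalSpace FE E)]
  [∀ x, AddCommGroup (E x)] [∀ x, Module ℝ (E x)] [∀ x, TopologicalSpace (E x)]
  [∀ x, IsTopologicalAddGroup (E x)] [∀ x, ContinuousSMul ℝ (E x)]
  [FiberBundle FE E] [VectorBundle ℝ FE E]

/-- `(∇_v τ)(Y) = ∇_{A,v}(τ(Y)) - τ(∇_v Y)` for connections `∇` on `TM` and `∇_A` on `E`. -/
def oneFormDerivative (D : CovariantDerivative (𝓡 8) E8 (fun x : M => TangentSpace (𝓡 8) x))
    (A : CovariantDerivative (𝓡 8) FE E) (τ : OneForms FE E) (x : M) (v : TangentSpace (𝓡 8) x)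
    (Y : Π y : M, TangentSpace (𝓡 8) y) : E x :=
  A (fun y => τ y (Y y)) x v - τ x (D Y x v)

/-- The derivatives of the scalar factor produced by `A` and by `D` cancel. Hence a field may be
exchanged for any other differentiable one with the same value at `x`. -/
theorem oneFormDerivative_tensorial
    (D : CovariantDerivative (𝓡 8) E8 (fun x : M => TangentSpace (𝓡 8) x))
    (A : CovariantDerivative (𝓡 8) FE E) (τ : OneForms FE E) (x : M)
    (v : TangentSpace (𝓡 8) x) :
    TensorialAt (𝓡 8) E8 (oneFormDerivative D A τ x v) x where
  smul {f Y} hf hY := by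
    have h1 : (fun y => τ y ((f • Y) y)) = f • fun y => τ y (Y y) := by
      ext y
      simp
    rw [oneFormDerivative, h1, A.isCovariantDerivativeOn.leibniz (mdifferentiableAt_apply τ hY) hf,
      D.isCovariantDerivativeOn.leibniz hY hf]
    simp [oneFormDerivative]
    module
  add {Y Y'} hY hY' := by
    have h1 : (fun y => τ y ((Y + Y') y)) = (fun y => τ y (Y y)) + fun y => τ y (Y' y) := by
      ext y
      simp
    rw [oneFormDerivative, h1, A.isCovariantDerivativeOn.add (mdifferentiableAt_apply τ hY)
      (mdifferentiableAt_apply τ hY'), D.isCovariantDerivativeOn.add hY hY']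
    simp [oneFormDerivative]
    abel

theorem dA_apply [FiniteDimensional ℝ FE] (A : CovariantDerivative (𝓡 8) FE E)
    (τ : OneForms FE E) (x : M) (u v : TangentSpace (𝓡 8) x) :
    dA A τ x ![u, v] = dAux A τ (extend E8 u) (extend E8 v) x := rfl

/-- `d_A τ` in terms of a connection with torsion. -/
theorem dA_eq_oneFormDerivative [FiniteDimensional ℝ FE]
    (D : CovariantDerivative (𝓡 8) E8 (fun x : M => TangentSpace (𝓡 8) x))
    (A : CovariantDerivative (𝓡 8) FE E) (τ : OneForms FE E) (x : M)
    (u v : TangentSpace (𝓡 8) x) :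
    dA A τ x ![u, v] = oneFormDerivative D A τ x u (extend E8 v)
      - oneFormDerivative D A τ x v (extend E8 u) + τ x (D.torsion x u v) := by
  rw [dA_apply, D.torsion_apply_eq_extend]
  simp only [dAux, oneFormDerivative, extend_apply_self, map_sub]
  abel

variable [RiemannianBundle (fun x : M => TangentSpace (𝓡 8) x)]
  [IsContMDiffRiemannianBundle (𝓡 8) ∞ E8 (fun x : M => TangentSpace (𝓡 8) x)]

theorem mvfderiv_inner_eq
    {D : CovariantDerivative (𝓡 8) E8 (fun x : M => TangentSpace (𝓡 8) x)}
    (hD : D.IsMetricCompatible) {x : M} {Y Z : Π y : M, TangentSpace (𝓡 8) y}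
    (hY : SectionDiffAt E8 Y x) (hZ : SectionDiffAt E8 Z x) (v : TangentSpace (𝓡 8) x) :
    mvfderiv (𝓡 8) (fun y => inner ℝ (Y y) (Z y)) x v
      = inner ℝ (D Y x v) (Z x) + inner ℝ (Y x) (D Z x v) := by
  have := hD.mvfderiv_inner_eq (extend E8 v) hY hZ
  simpa using this

/-- The Levi-Civita connection and a metric connection with totally antisymmetric torsion have
the same diagonal. -/
theorem leviCivita_self
    {D : CovariantDerivative (𝓡 8) E8 (fun x : M => TangentSpace (𝓡 8) x)}
    (hD : D.IsMetricCompatible) {x : M} (v : TangentSpace (𝓡 8) x)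
    (hT : ∀ w, inner ℝ (D.torsion x v w) v = (0 : ℝ)) :
    leviCivita (extend E8 v) x v = D (extend E8 v) x v := by
  -- For X = Y = v, metricity turns the Koszul expression into 2⟨∇_v v, w⟩ + 2⟨T(v, w), v⟩, and the
  -- torsion term vanishes by `hT`.
  have hkoszul (w : TangentSpace (𝓡 8) x) :
      koszul (extend E8 v) (extend E8 v) (extend E8 w) x
        = 2 * inner ℝ w (D (extend E8 v) x v) := by
    have hv : SectionDiffAt E8 (extend E8 v) x := mdifferentiableAt_extend ..
    have hw : SectionDiffAt E8 (extend E8 w) x := mdifferentiableAt_extend ..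
    have h1 := hT w
    rw [D.torsion_apply_eq_extend] at h1
    simp only [koszul, mvfderiv_inner_eq hD hv hw, mvfderiv_inner_eq hD hv hv,
      VectorField.mlieBracket_self, extend_apply_self, inner_sub_left, Pi.zero_apply,
      inner_zero_left] at h1 ⊢
    rw [real_inner_comm w, real_inner_comm v (D (extend E8 v) x w),
      real_inner_comm v (D (extend E8 w) x v)] at *
    linarith
  simp only [leviCivita, hkoszul]
  exact sum_two_mul_inner_smul _ _

theorem codifferential_eq
    {D : CovariantDerivative (𝓡 8) E8 (fun x : M => TangentSpace (𝓡 8) x)}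
    (hD : D.IsMetricCompatible) (A : CovariantDerivative (𝓡 8) FE E) (τ : OneForms FE E) {x : M}
    (hT : ∀ v w, inner ℝ (D.torsion x v w) v = (0 : ℝ)) :
    codifferential A τ x = -∑ i, oneFormDerivative D A τ x
      (stdOrthonormalBasis ℝ (TangentSpace (𝓡 8) x) i)
      (extend E8 (stdOrthonormalBasis ℝ (TangentSpace (𝓡 8) x) i)) := by
  simp only [codifferential, oneFormDerivative]
  congr 1
  refine Finset.sum_congr rfl fun i _ => ?_
  rw [leviCivita_self hD _ (hT _)]

end CovariantDerivativeOfOneForm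

/-! ### Trace and antisymmetric part under Clifford multiplication -/

section LinearAlgebra

variable {V : Type*} [NormedAddCommGroup V] [InnerProductSpace ℝ V]

/-- The infinitesimal version of `sum_tmul_eq_of_biorthogonal`. -/
theorem sum_tmul_add_tmul_eq_zero {S W : Type*} [AddCommGroup S] [Module ℝ S] [AddCommGroup W]
    [Module ℝ W] {ι : Type*} [Fintype ι] (e : OrthonormalBasis ι ℝ V) {a b : ι → V}
    (hab : ∀ k l, inner ℝ (b k) (e l) + inner ℝ (e k) (a l) = (0 : ℝ))
    (f : V →ₗ[ℝ] S) (g : V →ₗ[ℝ] W) :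
    ∑ k, (f (a k) ⊗ₜ[ℝ] g (e k) + f (e k) ⊗ₜ[ℝ] g (b k)) = 0 := by
  have hf (k : ι) : f (a k) = ∑ l, (inner ℝ (e l) (a k) : ℝ) • f (e l) := by
    conv_lhs => rw [← e.sum_repr' (a k)]
    simp
  have hg (k : ι) : g (b k) = -∑ l, (inner ℝ (e k) (a l) : ℝ) • g (e l) := by
    conv_lhs => rw [← e.sum_repr' (b k)]
    rw [map_sum, ← Finset.sum_neg_distrib]
    refine Finset.sum_congr rfl fun l _ => ?_
    rw [map_smul, real_inner_comm, eq_neg_of_add_eq_zero_left (hab k l), neg_smul]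
  simp only [hf, hg, Finset.sum_add_distrib, TensorProduct.sum_tmul, TensorProduct.tmul_neg,
    TensorProduct.tmul_sum, Finset.sum_neg_distrib]
  rw [Finset.sum_comm]
  simp only [TensorProduct.smul_tmul]
  exact add_neg_cancel _

/-- Clifford multiplication by a bilinear form splits into the trace and the antisymmetrization. -/
theorem IsCliffordAction.sum_rTensor_eq [FiniteDimensional ℝ V] {S W : Type*}
    [NormedAddCommGroup S] [InnerProductSpace ℝ S] [AddCommGroup W] [Module ℝ W]
    {c : V →L[ℝ] S →L[ℝ] S} (hc : IsCliffordAction c) (η : S)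
    (N : Fin (finrank ℝ V) → Fin (finrank ℝ V) → W) {α : V [⋀^Fin 2]→ₗ[ℝ] W}
    (hα : ∀ i j, α ![stdOrthonormalBasis ℝ V i, stdOrthonormalBasis ℝ V j] = N i j - N j i) :
    ∑ i, (c (stdOrthonormalBasis ℝ V i)).toLinearMap.rTensor W
        (∑ j, c (stdOrthonormalBasis ℝ V j) η ⊗ₜ[ℝ] N i j)
      = η ⊗ₜ[ℝ] (-∑ i, N i i) + cliffordTwo c η W α := by
  let e := stdOrthonormalBasis ℝ V
  have hanti (i j : Fin (finrank ℝ V)) : c (e i) (c (e j) η) ⊗ₜ[ℝ] N j i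
      = -(c (e j) (c (e i) η) ⊗ₜ[ℝ] N j i) - (if i = j then (2 : ℝ) else 0) • (η ⊗ₜ[ℝ] N j i) := by
    rw [hc.anticomm, e.inner_eq_ite]
    by_cases h : i = j <;> simp [h, TensorProduct.sub_tmul, TensorProduct.neg_tmul,
      ← TensorProduct.smul_tmul']
  -- With P the sum against N_{ij} and Q the sum against N_{ji}, anticommutation gives Q = −P − 2 η
  -- ⊗ tr N, so α·η = ½(P − Q) = P + η ⊗ tr N.
  have hswap : ∑ i, ∑ j, c (e i) (c (e j) η) ⊗ₜ[ℝ] N j i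
      = -(∑ i, ∑ j, c (e i) (c (e j) η) ⊗ₜ[ℝ] N i j) - (2 : ℝ) • ∑ i, η ⊗ₜ[ℝ] N i i := by
    simp only [hanti, Finset.sum_sub_distrib, Finset.sum_neg_distrib, ite_smul, zero_smul,
      Finset.sum_ite_eq, Finset.mem_univ, if_true, Finset.smul_sum]
    rw [Finset.sum_comm]
  have htwo : cliffordTwo c η W α = (1 / 2 : ℝ) • (∑ i, ∑ j, c (e i) (c (e j) η) ⊗ₜ[ℝ] N i j
      - ∑ i, ∑ j, c (e i) (c (e j) η) ⊗ₜ[ℝ] N j i) := by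
    simp only [cliffordTwo, LinearMap.coe_mk, AddHom.coe_mk, hα, TensorProduct.tmul_sub,
      Finset.sum_sub_distrib, e]
  rw [htwo, hswap, TensorProduct.tmul_neg, TensorProduct.tmul_sum]
  simp only [map_sum, LinearMap.rTensor_tmul]
  change ∑ i, ∑ j, c (e i) (c (e j) η) ⊗ₜ[ℝ] N i j = _
  module

end LinearAlgebra

/-! ### The twisted Dirac operator on τ·η -/

section Dirac

variable {M : Type*} [TopologicalSpace M] [ChartedSpace E8 M] [IsManifold (𝓡 8) ∞ M]
  [RiemannianBundle (fun x : M => TangentSpace (𝓡 8) x)]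
  {FS : Type*} [NormedAddCommGroup FS] [NormedSpace ℝ FS]
  {S : M → Type*} [TopologicalSpace (TotalSpace FS S)]
  [∀ x, NormedAddCommGroup (S x)] [∀ x, InnerProductSpace ℝ (S x)]
  [FiberBundle FS S] [VectorBundle ℝ FS S]

theorem IsAssociatedSpinor.isCayleySpinor {Ω : Spin7Structure M} {c : SpinorStructure FS S}
    {η : Π x : M, S x} (hη : IsAssociatedSpinor Ω c η) (x : M) :
    IsCayleySpinor (Ω.orientation x) (Ω.form x) (c.clifford x) (η x) where
  action := ⟨c.clifford_sq x, c.clifford_skew x⟩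
  rank_eq := by
    rw [← c.rank_eq]
    exact ((trivializationAt FS S x).continuousLinearEquivAt ℝ x
      (mem_baseSet_trivializationAt FS S x)).toLinearEquiv.finrank_eq
  norm_eq := hη.norm_eq x
  positive := hη.positive x
  form_eq := hη.form_eq x

theorem SpinorStructure.sectionDiffAt_clifford (c : SpinorStructure FS S) {x : M}
    {X : Π y : M, TangentSpace (𝓡 8) y} {σ : Π y : M, S y} (hX : SectionDiffAt E8 X x)
    (hσ : SectionDiffAt FS σ x) : SectionDiffAt FS (fun y => c.clifford y (X y) (σ y)) x := by
  have h1 : SectionDiffAt (FS →L[ℝ] FS) (fun y => c.clifford y (X y)) x :=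
    MDifferentiableAt.clm_bundle_apply (F₁ := E8) (F₂ := FS →L[ℝ] FS) (b := id)
      (E₂ := fun y => S y →L[ℝ] S y)
      ((c.smooth x).mdifferentiableAt (by simp)) hX
  exact MDifferentiableAt.clm_bundle_apply (F₁ := FS) (F₂ := FS) (b := id) h1 hσ

variable [FiniteDimensional ℝ FS]
  [IsContMDiffRiemannianBundle (𝓡 8) ∞ E8 (fun x : M => TangentSpace (𝓡 8) x)]
  [ContMDiffVectorBundle ∞ FS S (𝓡 8)] [IsContMDiffRiemannianBundle (𝓡 8) ∞ FS S]
  {FE : Type*} [NormedAddCommGroup FE] [NormedSpace ℝ FE]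
  {E : M → Type*} [TopologicalSpace (TotalSpace FE E)]
  [∀ x, AddCommGroup (E x)] [∀ x, Module ℝ (E x)] [∀ x, TopologicalSpace (E x)]
  [∀ x, IsTopologicalAddGroup (E x)] [∀ x, ContinuousSMul ℝ (E x)]
  [FiberBundle FE E] [VectorBundle ℝ FE E]

/-- `∇_v (τ · η) = (∇_v τ) · η`. -/
theorem IvanovConnection.tensorDerivative_oneFormToSpinor {c : SpinorStructure FS S}
    {η : Π y : M, S y} {x : M} (hη : SectionDiffAt FS η x) (I : IvanovConnection c η)
    (A : CovariantDerivative (𝓡 8) FE E) (τ : OneForms FE E) (v : TangentSpace (𝓡 8) x) :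
    tensorDerivative I.spin A (fun y => oneFormToSpinor c η E y (τ y)) x v
      = ∑ k, c.clifford x (stdOrthonormalBasis ℝ (TangentSpace (𝓡 8) x) k) (η x) ⊗ₜ[ℝ]
        oneFormDerivative I.tangent A τ x v
          (extend E8 (stdOrthonormalBasis ℝ (TangentSpace (𝓡 8) x) k)) := by
  have : ContMDiffVectorBundle 1 FS S (𝓡 8) := .of_le (n := ∞) (by simp)
  let e := stdOrthonormalBasis ℝ (TangentSpace (𝓡 8) x)
  let X (k : Fin (finrank ℝ (TangentSpace (𝓡 8) x))) (y : M) : TangentSpace (𝓡 8) y :=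
    extend E8 (e k) y
  have hXx (k) : X k x = e k := extend_apply_self ..
  have hX (k) : SectionDiffAt E8 (X k) x := mdifferentiableAt_extend ..
  -- The extensions `X k` are orthonormal only at `x`. With a dual frame, τ·η = ∑ (X_k·η) ⊗ τ(Z_k)
  -- holds on a neighbourhood and can be differentiated.
  obtain ⟨Z, hZ, hZx, hZX⟩ := exists_dual_frame hX (by simpa only [hXx] using e.orthonormal)
  have hσ (k) : SectionDiffAt FS (fun y => c.clifford y (X k y) (η y)) x :=
    c.sectionDiffAt_clifford (hX k) hη
  have hζ (k) : SectionDiffAt FE (fun y => τ y (Z k y)) x := mdifferentiableAt_apply τ (hZ k)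
  have hΨ : ∀ᶠ y in nhds x, oneFormToSpinor c η E y (τ y)
      = ∑ k, c.clifford y (X k y) (η y) ⊗ₜ[ℝ] τ y (Z k y) := by
    filter_upwards [hZX] with y hy
    have hcard : Fintype.card (Fin (finrank ℝ (TangentSpace (𝓡 8) x)))
        = finrank ℝ (TangentSpace (𝓡 8) y) := by
      rw [Fintype.card_fin]
      rfl
    exact sum_tmul_eq_of_biorthogonal (stdOrthonormalBasis ℝ (TangentSpace (𝓡 8) y)) hcard hy
      ((c.clifford y).flip (η y)).toLinearMap (τ y).toLinearMap
  -- ⟨Z_k, X_l⟩ is constant near `x`; differentiate it with the metric connection.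
  have hskew (k l) : inner ℝ (I.tangent (Z k) x v) (e l) + inner ℝ (e k) (I.tangent (X l) x v)
      = (0 : ℝ) := by
    have h1 := mvfderiv_inner_eq I.tangent_metric (hZ k) (hX l) v
    rw [hZx, hXx, hXx] at h1
    have h2 : (fun y => (inner ℝ (Z k y) (X l y) : ℝ)) =ᶠ[nhds x]
        fun _ => if k = l then (1 : ℝ) else 0 := hZX.mono fun y hy => hy k l
    have h3 : mvfderiv (𝓡 8) (fun y => (inner ℝ (Z k y) (X l y) : ℝ)) x = 0 := by
      rw [mvfderiv, h2.mfderiv_eq]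
      exact mvfderiv_const _
    rw [← h1, h3]
    rfl
  have hspin (k) : I.spin (fun y => c.clifford y (X k y) (η y)) x v
      = c.clifford x (I.tangent (X k) x v) (η x) := by
    rw [I.spin_clifford x (X k) η (hX k) hη v, I.parallel]
    simp
  have hA (k) : A (fun y => τ y (Z k y)) x v
      = oneFormDerivative I.tangent A τ x v (X k) + τ x (I.tangent (Z k) x v) := by
    rw [← (oneFormDerivative_tensorial I.tangent A τ x v).pointwise (hZ k) (hX k) (hZx k),
      oneFormDerivative, sub_add_cancel]
  rw [tensorDerivative_eq_sum I.spin A hσ hζ hΨ v]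
  simp only [hspin, hA, hZx, hXx, TensorProduct.tmul_add]
  -- The terms that differentiate the two frames cancel, leaving only ∇τ.
  have hzero := sum_tmul_add_tmul_eq_zero e hskew
    ((c.clifford x).flip (η x)).toLinearMap (τ x).toLinearMap
  simp only [Finset.sum_add_distrib] at hzero ⊢
  rw [add_left_comm]
  exact (congrArg _ hzero).trans (add_zero _)

variable [FiniteDimensional ℝ FE]

/-- The Dirac operator before the projection to `Λ²_7`. -/
theorem IvanovConnection.dirac_oneFormToSpinor {c : SpinorStructure FS S}
    {η : Π y : M, S y} {x : M} (hη : SectionDiffAt FS η x) (I : IvanovConnection c η)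
    (A : CovariantDerivative (𝓡 8) FE E) (τ : OneForms FE E) :
    dirac c I.spin A (fun y => oneFormToSpinor c η E y (τ y)) x
      = evenFormToSpinor c η E x
        (codifferential A τ x, dA A τ x - contractOneForm (I.torsionForm x) (τ x)) := by
  have hT (v w : TangentSpace (𝓡 8) x) : inner ℝ (I.tangent.torsion x v w) v = (0 : ℝ) := by
    rw [← I.torsion_eq]
    exact (I.torsionForm x).map_eq_zero_of_eq _ (i := 0) (j := 2) rfl (by decide)
  simp only [dirac, I.tensorDerivative_oneFormToSpinor hη, codifferential_eq I.tangent_metric A τ hT]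
  -- Here N_{ij} = (∇_{e_i}τ)(e_j). Its antisymmetrization is d_Aτ − ι_τT because the torsion term
  -- of d_Aτ is exactly ι_τT.
  refine IsCliffordAction.sum_rTensor_eq ⟨c.clifford_sq x, c.clifford_skew x⟩ (η x) _
    fun i j => ?_
  rw [AlternatingMap.sub_apply, dA_eq_oneFormDerivative I.tangent,
    contractOneForm_apply _ _ (I.torsion_eq x _ _), add_sub_cancel_right]

end Dirac

end Spin7

end

open Spin7 in
theorem mainTheorem10
    {M : Type*} [TopologicalSpace M] [ChartedSpace E8 M] [IsManifold (𝓡 8) ∞ M]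
    [RiemannianBundle (fun x : M => TangentSpace (𝓡 8) x)]
    [IsContMDiffRiemannianBundle (𝓡 8) ∞ E8 (fun x : M => TangentSpace (𝓡 8) x)]
    -- the spinor bundle
    {FS : Type*} [NormedAddCommGroup FS] [NormedSpace ℝ FS] [FiniteDimensional ℝ FS]
    {S : M → Type*} [TopologicalSpace (TotalSpace FS S)]
    [∀ x, NormedAddCommGroup (S x)] [∀ x, InnerProductSpace ℝ (S x)]
    [FiberBundle FS S] [VectorBundle ℝ FS S] [ContMDiffVectorBundle ∞ FS S (𝓡 8)]
    [IsContMDiffRiemannianBundle (𝓡 8) ∞ FS S]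
    -- the coefficient bundle
    {FE : Type*} [NormedAddCommGroup FE] [NormedSpace ℝ FE] [FiniteDimensional ℝ FE]
    {E : M → Type*} [TopologicalSpace (TotalSpace FE E)]
    [∀ x, AddCommGroup (E x)] [∀ x, Module ℝ (E x)] [∀ x, TopologicalSpace (E x)]
    [∀ x, IsTopologicalAddGroup (E x)] [∀ x, ContinuousSMul ℝ (E x)]
    [FiberBundle FE E] [VectorBundle ℝ FE E] [ContMDiffVectorBundle ∞ FE E (𝓡 8)]
    (Ω : Spin7Structure M) (c : SpinorStructure FS S)
    (η : ContMDiffSection (𝓡 8) FS ∞ S) (hη : IsAssociatedSpinor Ω c η)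
    (I : IvanovConnection c η) (A : CovariantDerivative (𝓡 8) FE E) :
    -- `τ ↦ τ · η` is an isomorphism `Λ¹ ⊗ E ≅ S⁻ ⊗ E`
    (∀ x : M, Function.Injective (oneFormToSpinor c η E x) ∧
      LinearMap.range (oneFormToSpinor c η E x) = chiralTwisted Ω c E (-1) x) ∧
    -- `(f, α) ↦ f η + α · η` is an isomorphism `(Λ⁰ ⊕ Λ²_7) ⊗ E ≅ S⁺ ⊗ E`
    (∀ x : M, Set.InjOn (evenFormToSpinor c η E x) (evenForms Ω E x) ∧
      (evenForms Ω E x).map (evenFormToSpinor c η E x) = chiralTwisted Ω c E 1 x) ∧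
    -- through them, the Dirac operator is `τ ↦ d_A^* τ ⊕ π₇(d_A τ - ι_τ T)`
    (∀ (τ : OneForms FE E) (x : M),
      (codifferential A τ x,
          pi7 (Ω.orientation x) (Ω.form x)
            (dA A τ x - contractOneForm (I.torsionForm x) (τ x))) ∈ evenForms Ω E x ∧
      dirac c I.spin A (fun y => oneFormToSpinor c η E y (τ y)) x =
        evenFormToSpinor c η E x
          (codifferential A τ x,
            pi7 (Ω.orientation x) (Ω.form x)
              (dA A τ x - contractOneForm (I.torsionForm x) (τ x)))) := by
  refine ⟨fun x => (hη.isCayleySpinor x).oneForm_isomorphism fun _ => rfl,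
    fun x => (hη.isCayleySpinor x).evenForm_isomorphism fun _ => rfl, fun τ x => ⟨?_, ?_⟩⟩
  · exact ⟨trivial, (hη.isCayleySpinor x).pi7_mem _⟩
  · rw [I.dirac_oneFormToSpinor ((η.contMDiff x).mdifferentiableAt (by simp))]
    -- The two sides now differ only by π₇ on the 2-form, which Clifford multiplication on `η` does
    -- not see.
    change η x ⊗ₜ[ℝ] _ + cliffordTwo (c.clifford x) (η x) (E x) _
      = η x ⊗ₜ[ℝ] _ + cliffordTwo (c.clifford x) (η x) (E x) _
    rw [(hη.isCayleySpinor x).cliffordTwo_pi7]
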